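/- Let $N\ge 2$, $K\in\mathbb{N}$, $e\in\mathbb{R}^K$ with positive entries, $\varrho\in\mathbb{R}^K$ with nonnegative entries, $(c_{jk})\in\mathbb{R}^{K\times K}$ and $\beta>0$. Let $\Lambda=\mathrm{Diag}(\varrho)$, $\Xi=\mathrm{Diag}(e)$, let $C$ be the matrix $(c_{jk})$ with its diagonal entries replaced by $0$, let $\langle A,B\rangle=\mathrm{Tr}(A^\top B)$, and let $\|\cdot\|_{\mathrm F}$ be the Frobenius norm of matrices and of tuples of matrices. For $Z=(X_2,\dots,X_N)\in(\mathbb{R}^{K\times K})^{N-1}$ put $$f_\beta(Z)=\sum_{i=2}^N\langle X_i,\Lambda\Xi C\Xi\rangle+\sum_{2\le i<j\le N}\langle X_i,\Xi\Lambda X_j\Xi C\Xi\rangle+\beta\sum_{2\le i<j\le N}\langle X_i,X_j\rangle,$$ $$\mathcal{S}=\{W\in\mathbb{R}^{K\times K}: We=\mathbf{1},\ W^\top\Xi\varrho=\varrho,\ \mathrm{Tr}(W)=0,\ W\ge0\},$$ and $F(Z)=f_\beta(Z)+\sum_{i=2}^N\delta_{\mathcal S}(X_i)$, where $\delta_{\mathcal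 S}$ is $0$ on $\mathcal S$ and $+\infty$ elsewhere. The $\ell_1$-penalized problem is $$\min\{f_\beta(Z): Z\in\mathcal{S}^{N-1}\}.\tag{P}$$ A point $Z\in\mathcal{S}^{N-1}$ is a KKT point of (P) if for each $i$ there are $u,v\in\mathbb{R}^K$, $w\in\mathbb{R}$ and an entrywise nonnegative $\Phi\in\mathbb{R}^{K\times K}$ with $\nabla_{X_i}f_\beta(Z)=ue^\top+(\Xi\varrho)v^\top+wI+\Phi$ and $\langle\Phi,X_i\rangle=0$. For $\sigma>0$, a run of the inexact proximal block coordinate descent is a sequence $Z^{(k)}=(X_i^{(k)})_{i=2}^N\in(\mathbb{R}^{K\times K})^{N-1}$, $k\ge0$, whose members need not be feasible, together with the exact block solutions $\bar Z^{(k)}=(\bar X_i^{(k)})_{i=2}^N$, $k\ge1$, given for $k\ge 0$ and $i=2,\dots,N$ by $$\bar X_i^{(k+1)}=\operatorname*{arg\,min}_{X_i\in\mathcal{S}}\ f_\beta\big(X_{2}^{(k+1)},\dots,X_{i-1}^{(k+1)},X_i,X_{i+1}^{(k)},\dots,X_N^{(k)}\big)+\frac{\sigma}{2}\|X_i-X_i^{(k)}\|_{\mathrm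 F}^2 .$$ Call a run admissible if - $\big(F(\bar Z^{(k)})\big)_{k\ge1}$ is non-increasing, and $F(\bar Z^{(k)})>\overline F$ for all $k\ge1$, where $\overline F=\lim_{k\to\infty}F(\bar Z^{(k)})$; - $\sum_{k=1}^\infty\|\bar Z^{(k)}-Z^{(k)}\|_{\mathrm F}<\infty$. Theorem. There is $\sigma_0>0$, depending only on $N,K,e,\varrho,c,\beta$, such that for every $\sigma\ge\sigma_0$: 1. for every admissible run, $(Z^{(k)})$ converges to a KKT point of (P); 2. there are $\eta>0$ and $\delta>0$, depending only on $\sigma$ and the same data, such that for every admissible run with $\sum_{k=1}^\infty\|\bar Z^{(k)}-Z^{(k)}\|_{\mathrm F}<\eta$, $Z^{(0)}\in\mathcal{S}^{N-1}$ and $\|Z^{(0)}-Z^\ast\|_{\mathrm F}<\delta$ for some global minimizer $Z^\ast$ of (P), $(Z^{(k)})$ converges to a global minimizer of (P). -/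

import Mathlib

open scoped Topology

namespace PBCD

/-- The variable `Z = (X_2, …, X_N) ∈ (ℝ^{K×K})^n` with `n = N - 1` blocks. The block `X_i`
(`2 ≤ i ≤ N`) is stored at the index `i - 2 : Fin n`, so the order of the blocks is that of `Fin n`. -/
abbrev Blocks (n K : ℕ) : Type := Fin n → Matrix (Fin K) (Fin K) ℝ

/-- The trace inner product `⟨A, B⟩ = Tr(Aᵀ B)`. -/
def matInner {K : ℕ} (A B : Matrix (Fin K) (Fin K) ℝ) : ℝ :=
  (A.transpose * B).trace

/-- The Frobenius norm of a matrix. -/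
noncomputable def frobNorm {K : ℕ} (A : Matrix (Fin K) (Fin K) ℝ) : ℝ :=
  Real.sqrt (∑ j, ∑ k, A j k ^ 2)

/-- The Frobenius norm of a tuple of matrices. -/
noncomputable def blocksNorm {n K : ℕ} (Z : Blocks n K) : ℝ :=
  Real.sqrt (∑ i, ∑ j, ∑ k, Z i j k ^ 2)

/-- The interaction matrix `C`: the effective interactions `c` between the elements, with the
diagonal removed. -/
def interaction {K : ℕ} (c : Matrix (Fin K) (Fin K) ℝ) : Matrix (Fin K) (Fin K) ℝ :=
  Matrix.of fun j k => if j = k then 0 else c j k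

/-- The discretized repulsive energy, with `Λ = Diag(ϱ)` and `Ξ = Diag(e)`:
`f(Z) = ∑_i ⟨X_i, Λ Ξ C Ξ⟩ + ∑_{i<j} ⟨X_i, Ξ Λ X_j Ξ C Ξ⟩`. -/
def energy {n K : ℕ} (e ϱ : Fin K → ℝ) (c : Matrix (Fin K) (Fin K) ℝ) (Z : Blocks n K) : ℝ :=
  (∑ i, matInner (Z i)
    (Matrix.diagonal ϱ * Matrix.diagonal e * interaction c * Matrix.diagonal e)) +
  ∑ i, ∑ j ∈ Finset.Ioi i, matInner (Z i)
    (Matrix.diagonal e * Matrix.diagonal ϱ * Z j *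
      Matrix.diagonal e * interaction c * Matrix.diagonal e)

/-- The `ℓ1`-penalized energy `f_β(Z) = f(Z) + β ∑_{i<j} ⟨X_i, X_j⟩`. -/
def penalized {n K : ℕ} (e ϱ : Fin K → ℝ) (c : Matrix (Fin K) (Fin K) ℝ) (β : ℝ)
    (Z : Blocks n K) : ℝ :=
  energy e ϱ c Z + β * ∑ i, ∑ j ∈ Finset.Ioi i, matInner (Z i) (Z j)

/-- The block feasible set
`𝒮 = {W : W e = 1, Wᵀ Ξ ϱ = ϱ, Tr W = 0, W ≥ 0}`. -/
def feasibleBlock {K : ℕ} (e ϱ : Fin K → ℝ) : Set (Matrix (Fin K) (Fin K) ℝ) :=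
  {W | W.mulVec e = (fun _ => 1) ∧
    W.transpose.mulVec ((Matrix.diagonal e).mulVec ϱ) = ϱ ∧
    W.trace = 0 ∧ ∀ j k, 0 ≤ W j k}

/-- The feasible set `𝒮^n` of the penalized problem. -/
def feasible {n K : ℕ} (e ϱ : Fin K → ℝ) : Set (Blocks n K) :=
  {Z | ∀ i, Z i ∈ feasibleBlock e ϱ}

/-- The indicator function `δ_S` of a set: `0` on `S` and `∞` off `S`. -/
noncomputable def delta {α : Type*} (S : Set α) (x : α) : EReal :=
  Set.indicator Sᶜ (fun _ => (⊤ : EReal)) x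

/-- `F(Z) = f_β(Z) + ∑_i δ_𝒮(X_i)`. -/
noncomputable def F {n K : ℕ} (e ϱ : Fin K → ℝ) (c : Matrix (Fin K) (Fin K) ℝ) (β : ℝ)
    (Z : Blocks n K) : EReal :=
  (penalized e ϱ c β Z : EReal) + ∑ i, delta (feasibleBlock e ϱ) (Z i)

/-- Global minimizers of the penalized problem: minimize `f_β` over `𝒮^n`. -/
def IsGlobalMinimizer {n K : ℕ} (e ϱ : Fin K → ℝ) (c : Matrix (Fin K) (Fin K) ℝ) (β : ℝ)
    (Z : Blocks n K) : Prop :=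
  Z ∈ feasible e ϱ ∧ ∀ W : Blocks n K, W ∈ feasible e ϱ → penalized e ϱ c β Z ≤ penalized e ϱ c β W

/-- The gradient of `f_β` with respect to the `i`-th block: its `(j, k)` entry is the partial
derivative of `f_β` in the `(j, k)` entry of `X_i`. -/
noncomputable def blockGradient {n K : ℕ} (e ϱ : Fin K → ℝ) (c : Matrix (Fin K) (Fin K) ℝ)
    (β : ℝ) (Z : Blocks n K) (i : Fin n) : Matrix (Fin K) (Fin K) ℝ :=
  Matrix.of fun j k =>
    deriv (fun t : ℝ =>
      penalized e ϱ c β (Function.update Z i (Z i + t • Matrix.single j k (1 : ℝ)))) 0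

/-- KKT points of the penalized problem: `Z` is feasible and, for every block, there are
multipliers `u` (for `X_i e = 1`), `v` (for `X_iᵀ Ξ ϱ = ϱ`), `w` (for `Tr X_i = 0`) and `Φ ≥ 0`
(for `X_i ≥ 0`) with `∇_i f_β(Z) = u eᵀ + (Ξ ϱ) vᵀ + w I + Φ` and `⟨Φ, X_i⟩ = 0`. -/
def IsKKTPoint {n K : ℕ} (e ϱ : Fin K → ℝ) (c : Matrix (Fin K) (Fin K) ℝ) (β : ℝ)
    (Z : Blocks n K) : Prop :=
  Z ∈ feasible e ϱ ∧
  ∀ i, ∃ (u v : Fin K → ℝ) (w : ℝ) (Φ : Matrix (Fin K) (Fin K) ℝ),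
    (∀ j k, 0 ≤ Φ j k) ∧
    matInner Φ (Z i) = 0 ∧
    blockGradient e ϱ c β Z i =
      Matrix.vecMulVec u e + Matrix.vecMulVec ((Matrix.diagonal e).mulVec ϱ) v +
        w • (1 : Matrix (Fin K) (Fin K) ℝ) + Φ

/-- The tuple `(Y_{<i}, W, Z_{>i})`. -/
def splice {n K : ℕ} (Y Z : Blocks n K) (i : Fin n) (W : Matrix (Fin K) (Fin K) ℝ) :
    Blocks n K :=
  fun j => if j < i then Y j else if j = i then W else Z j

/-- The objective of the `i`-th block problem, where the blocks before `i` have already been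
updated (`Znew`) and the others have not (`Zold`):
`W ↦ f_β(X^new_{<i}, W, X^old_{>i}) + (σ/2) ‖W - X^old_i‖_F²`. -/
noncomputable def blockObjective {n K : ℕ} (e ϱ : Fin K → ℝ) (c : Matrix (Fin K) (Fin K) ℝ)
    (β σ : ℝ) (Znew Zold : Blocks n K) (i : Fin n) (W : Matrix (Fin K) (Fin K) ℝ) : ℝ :=
  penalized e ϱ c β (splice Znew Zold i W) + σ / 2 * frobNorm (W - Zold i) ^ 2

/-- `Zbar` is the sequence of exact block solutions belonging to the (inexact, possibly
infeasible) proximal block coordinate descent iterates `Z`: for all `k ≥ 0` and all `i`,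
`X̄_i^{(k+1)}` minimizes over `𝒮` the `i`-th block objective built from `X_{<i}^{(k+1)}`,
`X_i^{(k)}` and `X_{>i}^{(k)}`. The value `Zbar 0` plays no role. -/
def IsBlockOptimalSequence {n K : ℕ} (e ϱ : Fin K → ℝ) (c : Matrix (Fin K) (Fin K) ℝ)
    (β σ : ℝ) (Z Zbar : ℕ → Blocks n K) : Prop :=
  ∀ k i, Zbar (k + 1) i ∈ feasibleBlock e ϱ ∧
    ∀ W ∈ feasibleBlock e ϱ,
      blockObjective e ϱ c β σ (Z (k + 1)) (Z k) i (Zbar (k + 1) i) ≤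
        blockObjective e ϱ c β σ (Z (k + 1)) (Z k) i W

/-- The standing assumptions on an inexact run `Z` with exact block solutions `Zbar` (indices
`k ≥ 1`): the energies `F(Z̄^{(k)})` are non-increasing and stay strictly above their limit, and
the inexactness is summable. -/
structure RunAssumptions {n K : ℕ} (e ϱ : Fin K → ℝ) (c : Matrix (Fin K) (Fin K) ℝ)
    (β σ : ℝ) (Z Zbar : ℕ → Blocks n K) : Prop where
  blockOptimal : IsBlockOptimalSequence e ϱ c β σ Z Zbar
  nonincreasing : ∀ k ≥ 1, F e ϱ c β (Zbar (k + 1)) ≤ F e ϱ c β (Zbar k)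
  summable : Summable fun k => blocksNorm (Zbar (k + 1) - Z (k + 1))
  above_limit : ∃ Flim : EReal,
    Filter.Tendsto (fun k => F e ϱ c β (Zbar k)) Filter.atTop (𝓝 Flim) ∧
      ∀ k ≥ 1, Flim < F e ϱ c β (Zbar k)

end PBCD

/-! On a compact polytope `P`, the energy is a quadratic `quad L A`, where `A` couples each block
only with later ones. This triangular form lets the first-order conditions of all block problems of
a sweep add up to one variational inequality, `IsProxStep`. Testing it with the previous point
leaves no term in `A` quadratic in the step, so the energy drops by `σ‖step‖²` up to inexactness,
for every `σ > 0`.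

The second ingredient is polyhedral. The derivative of a quadratic is affine in the base point, so
approximate criticality with a fixed set of supporting vertices is a system of linear inequalities.
Hence a residual `s` forces a critical point within `κ * s`, and there are only finitely many
critical values (`exists_isCritical_near`). Together with convergence of the energies to some `F`,
this gives a Łojasiewicz inequality of exponent 1/2: `√(q - F)` is bounded by a multiple of the last
step plus the errors. The usual telescoping of `√(q - F)` then makes the steps summable, and the
limit is critical; Farkas' lemma turns criticality into multipliers.

For global minimizers, the finitely many critical values leave a gap `γ` above the minimum. A start
near a minimizer with small total error brings the energy after one sweep below minimum plus `γ`, so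
the critical limit must be optimal. -/

namespace PBCD

/-! ### Farkas' lemma, by induction on the number of inequalities. -/

section Farkas

variable {E : Type*} [AddCommGroup E] [Module ℝ E]

/-- **Farkas' lemma** for finitely many linear inequalities. -/
theorem farkas {ι : Type*} (s : Finset ι) (a : ι → E →ₗ[ℝ] ℝ) (g : E →ₗ[ℝ] ℝ)
    (h : ∀ d, (∀ i ∈ s, 0 ≤ a i d) → 0 ≤ g d) :
    ∃ l : ι → ℝ, (∀ i, 0 ≤ l i) ∧ g = ∑ i ∈ s, l i • a i := by
  classical
  induction s using Finset.induction_on generalizing a g with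
  | empty =>
    refine ⟨0, fun _ => le_rfl, LinearMap.ext fun d => ?_⟩
    have h1 := h d (by simp)
    have h2 := h (-d) (by simp)
    rw [map_neg] at h2
    simp only [Finset.sum_empty, LinearMap.zero_apply]
    linarith
  | insert m s hm ih =>
    by_cases hg : ∀ d, (∀ i ∈ s, 0 ≤ a i d) → 0 ≤ g d
    · obtain ⟨l, hl, hgl⟩ := ih a g hg
      refine ⟨Function.update l m 0, fun i => ?_, ?_⟩
      · by_cases hi : i = m
        · subst hi; simp
        · simpa [hi] using hl i
      · rw [Finset.sum_insert hm, hgl]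
        simp only [Function.update_self, zero_smul, zero_add]
        refine Finset.sum_congr rfl fun i hi => ?_
        rw [Function.update_of_ne (ne_of_mem_of_not_mem hi hm)]
    · push Not at hg
      obtain ⟨d₀, hd₀, hgd₀⟩ := hg
      have hm₀ : a m d₀ < 0 := by
        by_contra! hc
        refine absurd (h d₀ fun i hi => ?_) (not_le.2 hgd₀)
        rcases Finset.mem_insert.1 hi with rfl | hi
        · exact hc
        · exact hd₀ i hi
      -- A direction violating only constraint `m`, scaled so that `d ↦ d + a m d • d₁` projects
      -- onto the kernel of `a m`. Composing a functional `q` with this projection gives `q + q d₁ •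
      -- a m`, and the induction hypothesis is applied to these composites.
      obtain ⟨d₁, hd₁, hgd₁, hm₁⟩ :
          ∃ d₁, (∀ i ∈ s, 0 ≤ a i d₁) ∧ g d₁ < 0 ∧ a m d₁ = -1 := by
        have hp : 0 < (-a m d₀)⁻¹ := inv_pos.2 (by linarith)
        refine ⟨(-a m d₀)⁻¹ • d₀, fun i hi => ?_, ?_, ?_⟩
        · simpa using mul_nonneg hp.le (hd₀ i hi)
        · simpa using mul_neg_of_pos_of_neg hp hgd₀
        · rw [map_smul, smul_eq_mul, inv_neg, neg_mul, inv_mul_cancel₀ hm₀.ne]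
      obtain ⟨l, hl, hgl⟩ := ih (fun i => a i + a i d₁ • a m) (g + g d₁ • a m) (by
        intro d hd
        have hval : ∀ q : E →ₗ[ℝ] ℝ, (q + q d₁ • a m) d = q (d + a m d • d₁) := by
          intro q
          simp [mul_comm]
        rw [hval]
        refine h _ fun i hi => ?_
        rcases Finset.mem_insert.1 hi with rfl | hi
        · simp [hm₁]
        · rw [← hval]
          exact hd i hi)
      refine ⟨Function.update l m (∑ i ∈ s, l i * a i d₁ - g d₁), fun i => ?_, ?_⟩
      · by_cases hi : i = m
        · subst hi
          have := Finset.sum_nonneg fun i hi => mul_nonneg (hl i) (hd₁ i hi)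
          simp only [Function.update_self]
          linarith
        · simpa [hi] using hl i
      · rw [Finset.sum_insert hm, Function.update_self]
        have hsum : ∑ i ∈ s, Function.update l m (∑ i ∈ s, l i * a i d₁ - g d₁) i • a i
            = ∑ i ∈ s, l i • a i := Finset.sum_congr rfl fun i hi => by
          rw [Function.update_of_ne (ne_of_mem_of_not_mem hi hm)]
        rw [hsum]
        simp only [smul_add, Finset.sum_add_distrib, smul_smul, ← Finset.sum_smul] at hgl
        ext d
        have := LinearMap.congr_fun hgl d
        simp only [LinearMap.add_apply, LinearMap.smul_apply, smul_eq_mul] at this ⊢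
        linarith

/-- Farkas' lemma with linear equations and linear inequalities. -/
theorem farkas_eq_le {ι κ : Type*} [Fintype ι] [Fintype κ] (b : ι → E →ₗ[ℝ] ℝ)
    (a : κ → E →ₗ[ℝ] ℝ) (s : Finset κ) (g : E →ₗ[ℝ] ℝ)
    (h : ∀ d, (∀ i, b i d = 0) → (∀ i ∈ s, 0 ≤ a i d) → 0 ≤ g d) :
    ∃ (m : ι → ℝ) (l : κ → ℝ), (∀ i, 0 ≤ l i) ∧ g = ∑ i, m i • b i + ∑ i ∈ s, l i • a i := by
  obtain ⟨l, hl, hg⟩ := farkas ((Finset.univ : Finset (ι ⊕ ι)).disjSum s)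
    (Sum.elim (Sum.elim b fun i => -b i) a) g (by
      intro d hd
      refine h d (fun i => ?_) fun i hi => ?_
      · have h1 := hd (.inl (.inl i)) (by simp)
        have h2 := hd (.inl (.inr i)) (by simp)
        simp only [Sum.elim_inl, Sum.elim_inr, LinearMap.neg_apply] at h1 h2
        linarith
      · simpa using hd (.inr i) (by simpa using hi))
  refine ⟨fun i => l (.inl (.inl i)) - l (.inl (.inr i)), fun i => l (.inr i), fun i => hl _, ?_⟩
  rw [hg, Finset.sum_disjSum]
  ext d
  simp [sub_mul, Finset.sum_sub_distrib]
  ring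

end Farkas

/-! ### Polyhedra and their extreme points. -/

section Polyhedra

variable {E : Type*} [AddCommGroup E] [Module ℝ E]

/-- A polyhedron is the solution set of finitely many linear inequalities. -/
def IsPolyhedron (P : Set E) : Prop :=
  ∃ T : Set ((E →ₗ[ℝ] ℝ) × ℝ), T.Finite ∧ P = {x | ∀ p ∈ T, p.1 x ≤ p.2}

theorem IsPolyhedron.le {f : E → ℝ} (hf : IsLinearMap ℝ f) (b : ℝ) :
    IsPolyhedron {x | f x ≤ b} :=
  ⟨{(hf.mk' f, b)}, Set.finite_singleton _, by simp⟩

theorem IsPolyhedron.forall {ι : Sort*} [Finite ι] {p : ι → E → Prop}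
    (h : ∀ i, IsPolyhedron {x | p i x}) : IsPolyhedron {x | ∀ i, p i x} := by
  choose T hT hp using h
  refine ⟨⋃ i, T i, Set.finite_iUnion hT, ?_⟩
  ext x
  have hx : ∀ i, p i x ↔ ∀ q ∈ T i, q.1 x ≤ q.2 := fun i => Set.ext_iff.1 (hp i) x
  simp only [Set.mem_ofPred_eq, hx, Set.mem_iUnion]
  exact ⟨fun h q ⟨i, hi⟩ => h i q hi, fun h i q hi => h q ⟨i, hi⟩⟩

theorem IsPolyhedron.and {p q : E → Prop} (hp : IsPolyhedron {x | p x})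
    (hq : IsPolyhedron {x | q x}) : IsPolyhedron {x | p x ∧ q x} := by
  obtain ⟨T, hT, hpT⟩ := hp
  obtain ⟨S, hS, hqS⟩ := hq
  refine ⟨T ∪ S, hT.union hS, ?_⟩
  ext x
  have h1 : p x ↔ _ := Set.ext_iff.1 hpT x
  have h2 : q x ↔ _ := Set.ext_iff.1 hqS x
  simp only [Set.mem_ofPred_eq, h1, h2, Set.mem_union]
  exact ⟨fun h r hr => hr.elim (h.1 r) (h.2 r), fun h => ⟨fun r hr => h r (.inl hr),
    fun r hr => h r (.inr hr)⟩⟩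

theorem IsPolyhedron.ge {f : E → ℝ} (hf : IsLinearMap ℝ f) (b : ℝ) :
    IsPolyhedron {x | b ≤ f x} := by
  have := IsPolyhedron.le (f := fun x => -f x)
    ⟨fun x y => by simp [hf.map_add, add_comm], fun c x => by simp [hf.map_smul]⟩ (-b)
  simpa using this

theorem IsPolyhedron.eq {f : E → ℝ} (hf : IsLinearMap ℝ f) (b : ℝ) :
    IsPolyhedron {x | f x = b} := by
  have := (IsPolyhedron.le hf b).and (IsPolyhedron.ge hf b)
  simpa [le_antisymm_iff] using this

theorem IsPolyhedron.convex {P : Set E} (hP : IsPolyhedron P) : Convex ℝ P := by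
  obtain ⟨T, -, rfl⟩ := hP
  intro x hx y hy a b ha hb hab p hp
  have h1 := mul_le_mul_of_nonneg_left (hx p hp) ha
  have h2 := mul_le_mul_of_nonneg_left (hy p hp) hb
  have h3 : (a + b) * p.2 = p.2 := by rw [hab, one_mul]
  simp only [map_add, map_smul, smul_eq_mul]
  linarith

/-- An extreme point is determined by its active constraints: if `x` and `y` share them, then `x + t
• (x - y)` is feasible for small `t > 0`, and `x` lies strictly between it and `y`. -/
theorem IsPolyhedron.finite_extremePoints {P : Set E} (hP : IsPolyhedron P) :
    (P.extremePoints ℝ).Finite := by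
  obtain ⟨T, hT, rfl⟩ := hP
  refine Set.Finite.of_injOn (f := fun x => {p ∈ T | p.1 x = p.2}) (t := 𝒫 T)
    (fun x _ => Set.sep_subset _ _) ?_ hT.finite_subsets
  intro x hx y hy hxy
  have hev : ∀ᶠ t : ℝ in 𝓝[>] 0, ∀ p ∈ T, p.1 (x + t • (x - y)) ≤ p.2 := by
    rw [Filter.eventually_all_finite hT]
    intro p hp
    rcases eq_or_lt_of_le (hx.1 p hp) with heq | hlt
    · have hy' : p.1 y = p.2 := (Set.ext_iff.1 hxy p).1 ⟨hp, heq⟩ |>.2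
      filter_upwards with t
      simp [heq, hy']
    · have hc : Filter.Tendsto (fun t : ℝ => p.1 (x + t • (x - y))) (𝓝[>] 0) (𝓝 (p.1 x)) := by
        have : Continuous fun t : ℝ => p.1 x + t * p.1 (x - y) := by fun_prop
        have h0 := this.tendsto 0
        simp only [zero_mul, add_zero] at h0
        refine (h0.mono_left nhdsWithin_le_nhds).congr fun t => ?_
        simp
      filter_upwards [hc.eventually_lt_const hlt] with t ht using ht.le
  obtain ⟨t, ht, ht0⟩ := (hev.and self_mem_nhdsWithin).exists
  have ht0 : 0 < t := ht0
  refine (hx.2 hy.1 (show x + t • (x - y) ∈ _ from ht) ?_).symm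
  have h1 : (1 + t) ≠ 0 := by positivity
  refine ⟨t / (1 + t), 1 / (1 + t), by positivity, by positivity, by field_simp; ring, ?_⟩
  have : x = (1 + t)⁻¹ • ((1 + t) • x) := by rw [smul_smul, inv_mul_cancel₀ h1, one_smul]
  conv_rhs => rw [this]
  simp only [div_eq_inv_mul, mul_smul, ← smul_add]
  congr 1
  module

end Polyhedra

/-! ### Polytopes and distance to the bottom face. -/

section Polytopes

variable {E : Type*} [NormedAddCommGroup E] [NormedSpace ℝ E]

theorem IsPolyhedron.isClosed [FiniteDimensional ℝ E] {P : Set E} (hP : IsPolyhedron P) :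
    IsClosed P := by
  obtain ⟨T, -, rfl⟩ := hP
  simp only [Set.ofPred_forall]
  exact isClosed_iInter fun p => isClosed_iInter fun _ =>
    isClosed_le p.1.continuous_of_finiteDimensional continuous_const

/-- A bounded polyhedron is a polytope. -/
theorem IsPolyhedron.exists_eq_convexHull {P : Set E} (hP : IsPolyhedron P)
    (hc : IsCompact P) : ∃ V : Set E, V.Finite ∧ P = convexHull ℝ V :=
  ⟨_, hP.finite_extremePoints, by
    conv_lhs => rw [← closure_convexHull_extremePoints hc hP.convex]
    exact (hP.finite_extremePoints.isClosed_convexHull (𝕜 := ℝ)).closure_eq⟩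

/-- Near its bottom face, a polytope in the upper half space is close to the bottom face, at a
linear rate; there is no low point if the bottom face is empty. -/
theorem exists_bottom_near {T : Set (E × ℝ)} (hT : T.Finite) (hpos : ∀ p ∈ T, 0 ≤ p.2) :
    ∃ κ : ℝ, 0 ≤ κ ∧ ∀ x s, (x, s) ∈ convexHull ℝ T → κ * s < 1 →
      ∃ x', (x', (0 : ℝ)) ∈ convexHull ℝ T ∧ ‖x - x'‖ ≤ κ * s := by
  obtain ⟨R, hR⟩ := ((isBounded_convexHull (s := T)).2 hT.isBounded).exists_norm_le
  obtain ⟨m, hm, hmT⟩ : ∃ m : ℝ, 0 < m ∧ ∀ p ∈ T, p.2 ≠ 0 → m ≤ p.2 := by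
    have : ∀ᶠ m : ℝ in 𝓝[>] 0, ∀ p ∈ T, p.2 ≠ 0 → m ≤ p.2 := by
      rw [Filter.eventually_all_finite hT]
      intro p hp
      by_cases h0 : p.2 = 0
      · simp [h0]
      · filter_upwards [nhdsWithin_le_nhds
          (eventually_lt_nhds ((hpos p hp).lt_of_ne' h0))] with m hm _ using hm.le
    obtain ⟨m, hm, h0⟩ := (this.and self_mem_nhdsWithin).exists
    exact ⟨m, h0, hm⟩
  set T₀ := {p ∈ T | p.2 = 0}
  set T₁ := {p ∈ T | p.2 ≠ 0}
  have hTT : T = T₀ ∪ T₁ := by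
    ext p
    by_cases hp : p.2 = 0 <;> simp [T₀, T₁, hp]
  have h₀ : ∀ p ∈ convexHull ℝ T₀, p.2 = 0 := fun p hp => by
    have : convexHull ℝ T₀ ⊆ {p | p.2 = 0} := convexHull_min (fun p hp => hp.2)
      (convex_hyperplane (f := fun p : E × ℝ => p.2) ⟨fun _ _ => rfl, fun _ _ => rfl⟩ 0)
    exact this hp
  have h₁ : ∀ p ∈ convexHull ℝ T₁, m ≤ p.2 := fun p hp => by
    have : convexHull ℝ T₁ ⊆ {p | m ≤ p.2} := convexHull_min (fun p hp => hmT p hp.1 hp.2)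
      (convex_halfSpace_ge (f := fun p : E × ℝ => p.2) ⟨fun _ _ => rfl, fun _ _ => rfl⟩ m)
    exact this hp
  -- `m` bounds the positive heights of generators from below. In a convex combination of a bottom
  -- point and a point of the hull of the higher generators, the latter has weight at most `s / m`,
  -- and the two are at most `2 * |R|` apart. The summand 1 makes `κ * s < 1` imply `s < m`, so that
  -- the bottom cannot be empty.
  refine ⟨(1 + 2 * |R|) / m, by positivity, fun x s hxs hs => ?_⟩
  have hlow : s < m := by
    by_contra! hc
    refine absurd hs (not_lt.2 ?_)
    rw [div_mul_eq_mul_div, one_le_div hm]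
    have := abs_nonneg R
    nlinarith
  rcases T₁.eq_empty_or_nonempty with hT₁ | hT₁
  · have hs0 : s = 0 := h₀ (x, s) (by rwa [hTT, hT₁, Set.union_empty] at hxs)
    subst hs0
    exact ⟨x, hxs, by simp⟩
  rcases T₀.eq_empty_or_nonempty with hT₀ | hT₀
  · have := h₁ (x, s) (by rwa [hTT, hT₀, Set.empty_union] at hxs)
    exact absurd this (not_le.2 hlow)
  have hxs' := hxs
  rw [hTT, convexHull_union hT₀ hT₁, mem_convexJoin] at hxs'
  obtain ⟨p, hp, q, hq, a, b, ha, hb, hab, hpq⟩ := hxs'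
  have hp2 := h₀ p hp
  have hq2 := h₁ q hq
  have hx : a • p.1 + b • q.1 = x := congrArg Prod.fst hpq
  have hs' : b * q.2 = s := by
    have := congrArg Prod.snd hpq
    simpa [hp2] using this
  have hpT : p ∈ convexHull ℝ T := convexHull_mono (Set.sep_subset _ _) hp
  have hqT : q ∈ convexHull ℝ T := convexHull_mono (Set.sep_subset _ _) hq
  refine ⟨p.1, by rw [← hp2]; exact hpT, ?_⟩
  have hdiff : x - p.1 = b • (q.1 - p.1) := by
    obtain rfl : a = 1 - b := by linarith
    rw [← hx]
    module
  have hn : ‖q.1 - p.1‖ ≤ 2 * |R| := by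
    have h1 := (norm_fst_le q).trans (hR q hqT)
    have h2 := (norm_fst_le p).trans (hR p hpT)
    have h3 := norm_sub_le q.1 p.1
    have h4 := le_abs_self R
    linarith
  rw [hdiff, norm_smul, Real.norm_of_nonneg hb, ← hs', div_mul_eq_mul_div, le_div_iff₀ hm]
  have := abs_nonneg R
  calc b * ‖q.1 - p.1‖ * m ≤ b * (2 * |R|) * q.2 := by gcongr
    _ ≤ (1 + 2 * |R|) * (b * q.2) := by nlinarith [mul_nonneg hb (hm.le.trans hq2)]

end Polytopes

/-! ### Error bound for critical points of a quadratic on a polytope. -/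

section Quadratic

variable {E : Type*} [NormedAddCommGroup E] [NormedSpace ℝ E]
  (L : E →L[ℝ] ℝ) (A : E →L[ℝ] E →L[ℝ] ℝ)

/-- The quadratic function with linear part `L` and quadratic part given by the (not necessarily
symmetric) bilinear form `A`. -/
noncomputable def quad (x : E) : ℝ := L x + A x x

/-- The derivative of `quad L A` at `x`. -/
noncomputable def slope (x : E) : E →L[ℝ] ℝ := L + A x + A.flip x

theorem slope_apply (x d : E) : slope L A x d = L d + A x d + A d x := rfl

theorem quad_sub_quad (x y : E) :
    quad L A y - quad L A x = slope L A x (y - x) + A (y - x) (y - x) := by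
  simp only [quad, slope_apply, map_sub, sub_apply]
  ring

theorem continuous_quad : Continuous (quad L A) := by
  unfold quad
  fun_prop

theorem abs_le_opNorm₂ (x y : E) : |A x y| ≤ ‖A‖ * ‖x‖ * ‖y‖ := A.le_opNorm₂ x y

/-- First-order critical points of `quad L A` on `P`. -/
def IsCritical (P : Set E) (x : E) : Prop := x ∈ P ∧ ∀ w ∈ P, 0 ≤ slope L A x (w - x)

theorem sum_mul_le_sum_mul_of_minimal {ι : Type*} [Fintype ι] {U : Set ι} {m a b : ι → ℝ}
    (hm : ∀ i ∈ U, ∀ j, m i ≤ m j) (ha : a ∈ stdSimplex ℝ ι) (haU : ∀ i, i ∉ U → a i = 0)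
    (hb : b ∈ stdSimplex ℝ ι) : ∑ i, a i * m i ≤ ∑ i, b i * m i := by
  have h1 : ∀ j, ∑ i, a i * m i ≤ m j := fun j => by
    calc ∑ i, a i * m i ≤ ∑ i, a i * m j := Finset.sum_le_sum fun i _ => by
          by_cases hi : i ∈ U
          · exact mul_le_mul_of_nonneg_left (hm i hi j) (ha.1 i)
          · simp [haU i hi]
      _ = m j := by rw [← Finset.sum_mul, ha.2, one_mul]
  calc ∑ i, a i * m i = ∑ j, b j * ∑ i, a i * m i := by rw [← Finset.sum_mul, hb.2, one_mul]
    _ ≤ ∑ j, b j * m j :=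
      Finset.sum_le_sum fun j _ => mul_le_mul_of_nonneg_left (h1 j) (hb.1 j)

variable {ι : Type*} [Fintype ι] (v : ι → E)

/-- The point with weights `w` in the polytope with vertices `v`. -/
noncomputable def combo : (ι → ℝ) →L[ℝ] E := (Fintype.linearCombination ℝ v).toContinuousLinearMap

theorem combo_apply (w : ι → ℝ) : combo v w = ∑ i, w i • v i := rfl

theorem apply_combo (f : E →L[ℝ] ℝ) (w : ι → ℝ) : f (combo v w) = ∑ i, w i * f (v i) := by
  simp [combo_apply]

/-- Pairs of weights `w`, supported on `U`, and a tolerance `s ∈ [0, 1]` within which every vertex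
in `U` minimizes the derivative at the point with weights `w`. -/
def nearCritical (U : Set ι) : Set ((ι → ℝ) × ℝ) :=
  {p | ((∀ i, 0 ≤ p.1 i) ∧ ∑ i, p.1 i = 1) ∧ (∀ i, i ∉ U → p.1 i = 0) ∧
    (0 ≤ p.2 ∧ p.2 ≤ 1) ∧ ∀ i, i ∈ U → ∀ j,
      -L (v j - v i) ≤ A (combo v p.1) (v j - v i) + A (v j - v i) (combo v p.1) + p.2}

variable {L A v} in
theorem slope_le_of_mem_nearCritical {U : Set ι} {p : (ι → ℝ) × ℝ}
    (hp : p ∈ nearCritical L A v U) {i : ι} (hi : i ∈ U) (j : ι) :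
    slope L A (combo v p.1) (v i) ≤ slope L A (combo v p.1) (v j) + p.2 := by
  have := hp.2.2.2 i hi j
  simp only [slope_apply]
  simp only [map_sub, sub_apply] at this
  linarith

/-- With `U` fixed, every condition is linear in `(w, s)`, because the derivative of a quadratic is
affine in the base point. -/
theorem isPolyhedron_nearCritical (U : Set ι) : IsPolyhedron (nearCritical L A v U) := by
  refine .and (.and (.forall fun i => .ge ⟨fun _ _ => rfl, fun _ _ => rfl⟩ _)
      (.eq ⟨fun x y => ?_, fun c x => ?_⟩ _))
    (.and (.forall fun i => .forall fun _ => .eq ⟨fun _ _ => rfl, fun _ _ => rfl⟩ _)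
    (.and (.and (.ge ⟨fun _ _ => rfl, fun _ _ => rfl⟩ _) (.le ⟨fun _ _ => rfl, fun _ _ => rfl⟩ _))
      (.forall fun i => .forall fun _ => .forall fun j =>
        .ge ⟨fun x y => ?_, fun c x => ?_⟩ _)))
  · simp [Finset.sum_add_distrib]
  · simp [Finset.mul_sum]
  · simp only [Prod.fst_add, Prod.snd_add, map_add, add_apply]
    ring
  · simp only [Prod.smul_fst, Prod.smul_snd, map_smul, smul_apply, smul_eq_mul]
    ring

theorem isCompact_nearCritical (U : Set ι) : IsCompact (nearCritical L A v U) := by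
  refine (isCompact_Icc (a := ((0, 0) : (ι → ℝ) × ℝ)) (b := (1, 1))).of_isClosed_subset
    (isPolyhedron_nearCritical L A v U).isClosed fun p hp => ?_
  obtain ⟨⟨h0, h1⟩, -, ⟨h2, h3⟩, -⟩ := hp
  refine ⟨⟨h0, h2⟩, ⟨fun i => ?_, h3⟩⟩
  rw [show ((1, 1) : (ι → ℝ) × ℝ).1 i = ∑ i, p.1 i from h1.symm]
  exact Finset.single_le_sum (fun i _ => h0 i) (Finset.mem_univ i)

variable {L A v} in
theorem slope_combo_le_of_mem_nearCritical {U : Set ι} {w a b : ι → ℝ}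
    (hw : (w, (0 : ℝ)) ∈ nearCritical L A v U) (ha : a ∈ stdSimplex ℝ ι)
    (haU : ∀ i, i ∉ U → a i = 0) (hb : b ∈ stdSimplex ℝ ι) :
    slope L A (combo v w) (combo v a) ≤ slope L A (combo v w) (combo v b) := by
  rw [apply_combo, apply_combo]
  refine sum_mul_le_sum_mul_of_minimal (fun i hi j => ?_) ha haU hb
  simpa using slope_le_of_mem_nearCritical hw hi j

variable {L A v} in
-- Both weights live on `U`, whose vertices minimize the derivative at both points, so both
-- derivatives vanish along the difference. Expanding from either end leaves the same second-order
-- term for both signs of the energy difference. Each `U` thus carries at most one critical value.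
theorem quad_eq_of_mem_nearCritical {U : Set ι} {w w' : ι → ℝ}
    (hw : (w, (0 : ℝ)) ∈ nearCritical L A v U) (hw' : (w', (0 : ℝ)) ∈ nearCritical L A v U) :
    quad L A (combo v w) = quad L A (combo v w') := by
  have key : ∀ a b : ι → ℝ, (a, (0 : ℝ)) ∈ nearCritical L A v U →
      (b, (0 : ℝ)) ∈ nearCritical L A v U →
      slope L A (combo v a) (combo v b - combo v a) = 0 := fun a b ha hb => by
    rw [map_sub, sub_eq_zero]
    exact (slope_combo_le_of_mem_nearCritical ha hb.1 hb.2.1 ha.1).antisymm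
      (slope_combo_le_of_mem_nearCritical ha ha.1 ha.2.1 hb.1)
  have h1 := quad_sub_quad L A (combo v w) (combo v w')
  have h2 := quad_sub_quad L A (combo v w') (combo v w)
  rw [key _ _ hw hw'] at h1
  rw [key _ _ hw' hw] at h2
  simp only [map_sub, sub_apply] at h1 h2
  linarith

/-- **Error bound for critical points.** On a polytope, a point whose criticality residual `s` is
small lies within `κ * s` of a critical point, and the critical values are finite in number. -/
theorem exists_isCritical_near {P : Set E} (hP : IsPolyhedron P) (hc : IsCompact P) :
    ∃ κ : ℝ, 0 ≤ κ ∧ ∃ S : Set ℝ, S.Finite ∧ ∀ x ∈ P, ∀ s, 0 ≤ s → κ * s < 1 →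
      (∀ w ∈ P, -(s * ‖w - x‖) ≤ slope L A x (w - x)) →
      ∃ x', IsCritical L A P x' ∧ ‖x - x'‖ ≤ κ * s ∧ quad L A x' ∈ S := by
  classical
  obtain ⟨V, hV, hPV⟩ := hP.exists_eq_convexHull hc
  let := hV.fintype
  set v : V → E := Subtype.val with hv
  have hPv : ∀ y, y ∈ P ↔ ∃ w ∈ stdSimplex ℝ V, combo v w = y := fun y => by
    rw [hPV, hV.convexHull_eq_image, Set.mem_image]
    simp only [combo_apply, hv]
    simp
  obtain ⟨R, hR⟩ := hc.isBounded.exists_norm_le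
  set D : ℝ := 1 + 2 * |R| with hD
  have hD0 : 0 < D := by positivity
  have hVP : ∀ i, v i ∈ P := fun i => hPV ▸ subset_convexHull ℝ V i.2
  have hVD : ∀ i j, ‖v j - v i‖ ≤ D := fun i j => by
    have h1 := hR _ (hVP i)
    have h2 := hR _ (hVP j)
    have h3 := norm_sub_le (v j) (v i)
    have h4 := le_abs_self R
    linarith
  have hbot : ∀ U : Set V, ∃ κ : ℝ, 0 ≤ κ ∧ ∀ w s, (w, s) ∈ nearCritical L A v U → κ * s < 1 →
      ∃ w', (w', (0 : ℝ)) ∈ nearCritical L A v U ∧ ‖w - w'‖ ≤ κ * s := fun U => by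
    obtain ⟨T, hT, hQT⟩ := (isPolyhedron_nearCritical L A v U).exists_eq_convexHull
      (isCompact_nearCritical L A v U)
    rw [hQT]
    refine exists_bottom_near hT fun p hp => ?_
    have : p ∈ nearCritical L A v U := hQT ▸ subset_convexHull ℝ T hp
    exact this.2.2.1.1
  choose κ hκ hκU using hbot
  have hκsum : ∀ U, κ U ≤ ∑ U, κ U := fun U =>
    Finset.single_le_sum (fun U _ => hκ U) (Finset.mem_univ U)
  have hκ0 : 0 ≤ ∑ U, κ U := Finset.sum_nonneg fun U _ => hκ U
  -- The residual `s` becomes the tolerance `D * s` on vertex differences, the sum dominates `κ U`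
  -- for all supports, and `‖combo v‖` converts distance of weights to distance of points. The added
  -- ones make `κ * s < 1` imply `D * s ≤ 1` and the smallness needed for each `U`.
  refine ⟨(1 + ∑ U, κ U) * D * (1 + ‖combo v‖), by positivity,
    ⋃ U : Set V, (fun w => quad L A (combo v w)) '' {w | (w, (0 : ℝ)) ∈ nearCritical L A v U},
    Set.finite_iUnion fun U => Set.Subsingleton.finite ?_, fun x hx s hs hκs hres => ?_⟩
  · rintro _ ⟨w, hw, rfl⟩ _ ⟨w', hw', rfl⟩
    exact quad_eq_of_mem_nearCritical hw hw'
  obtain ⟨w, hw, rfl⟩ := (hPv x).1 hx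
  have hDs : (1 + ∑ U, κ U) * (D * s) < 1 := by
    refine lt_of_le_of_lt ?_ hκs
    have : 0 ≤ (1 + ∑ U, κ U) * (D * s) * ‖combo v‖ := by positivity
    linarith
  have hmem : (w, D * s) ∈ nearCritical L A v {i | w i ≠ 0} := by
    have h2 : 0 ≤ (∑ U, κ U) * (D * s) := by positivity
    refine ⟨hw, fun i hi => not_not.1 hi, ⟨by positivity, by linarith⟩, fun i hi j => ?_⟩
    have hwi : 0 < w i := (hw.1 i).lt_of_ne' hi
    -- Moving the whole weight of `i` to `j` stays in the polytope. The residual bound is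
    -- homogeneous in the displacement, so `w i` cancels, however small it is.
    have hmemP : combo v w + w i • (v j - v i) ∈ P := by
      refine (hPv _).2 ⟨w + w i • (Pi.single j 1 - Pi.single i 1), ⟨fun k => ?_, ?_⟩, ?_⟩
      · have h0 := hw.1 k
        simp only [Pi.add_apply, Pi.smul_apply, Pi.sub_apply, Pi.single_apply, smul_eq_mul]
        split_ifs with h1 h2 h2
        · simpa using h0
        · linarith
        · subst h2; simp
        · simpa using h0
      · simp [Finset.sum_add_distrib, ← Finset.mul_sum, hw.2]
      · rw [map_add, map_smul, map_sub]
        simp [combo_apply, Pi.single_apply]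
    have := hres _ hmemP
    rw [add_sub_cancel_left, map_smul, smul_eq_mul, norm_smul, Real.norm_of_nonneg hwi.le] at this
    have h3 : w i * -(s * ‖v j - v i‖) ≤ w i * slope L A (combo v w) (v j - v i) := by linarith
    have h4 := le_of_mul_le_mul_left h3 hwi
    rw [slope_apply] at h4
    have h5 := mul_le_mul_of_nonneg_left (hVD i j) hs
    show -L (v j - v i) ≤ A (combo v w) (v j - v i) + A (v j - v i) (combo v w) + D * s
    linarith
  have hDs0 : 0 ≤ D * s := by positivity
  obtain ⟨w', hw', hww'⟩ := hκU _ w (D * s) hmem (by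
    have := mul_le_mul_of_nonneg_right (hκsum {i | w i ≠ 0}) hDs0
    linarith)
  refine ⟨combo v w', ⟨(hPv _).2 ⟨w', hw'.1, rfl⟩, fun y hy => ?_⟩, ?_,
    Set.mem_iUnion.2 ⟨_, w', hw', rfl⟩⟩
  · obtain ⟨b, hb, rfl⟩ := (hPv y).1 hy
    rw [map_sub, sub_nonneg]
    exact slope_combo_le_of_mem_nearCritical hw' hw'.1 hw'.2.1 hb
  · rw [← map_sub]
    refine ((combo v).le_opNorm _).trans ?_
    have h1 := hκsum {i | w i ≠ 0}
    calc ‖combo v‖ * ‖w - w'‖ ≤ (1 + ‖combo v‖) * ((1 + ∑ U, κ U) * (D * s)) := by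
          gcongr
          · linarith
          · refine hww'.trans ?_
            gcongr
            linarith
      _ = _ := by ring

end Quadratic

/-! ### Real sequences and finite sets of values. -/

section Scalar

theorem le_add_of_sq_le {d c b : ℝ} (hc : 0 ≤ c) (hb : 0 ≤ b) (h : d ^ 2 ≤ c ^ 2 + b * d) :
    d ≤ c + b := by
  by_contra! hlt
  nlinarith

/-- Summing the recursion bounds each partial sum by half the preceding one plus a constant. -/
theorem summable_of_le_half_add {d a : ℕ → ℝ} (hd : ∀ k, 0 ≤ d k) (ha : Summable a)
    (ha0 : ∀ k, 0 ≤ a k) (h : ∀ k, d (k + 1) ≤ d k / 2 + a k) : Summable d := by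
  have key : ∀ n, ∑ k ∈ Finset.range n, d k ≤ 2 * (d 0 + ∑' k, a k) := fun n => by
    induction n with
    | zero =>
      have : 0 ≤ ∑' k, a k := tsum_nonneg ha0
      have := hd 0
      simp only [Finset.range_zero, Finset.sum_empty]
      linarith
    | succ n ih =>
      have h1 : ∑ k ∈ Finset.range n, d (k + 1)
          ≤ (∑ k ∈ Finset.range n, d k) / 2 + ∑ k ∈ Finset.range n, a k := by
        rw [Finset.sum_div, ← Finset.sum_add_distrib]
        exact Finset.sum_le_sum fun k _ => h k
      have h2 := ha.sum_le_tsum (Finset.range n) fun k _ => ha0 k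
      have := hd 0
      rw [Finset.sum_range_succ']
      linarith
  exact summable_of_sum_range_le hd key

theorem summable_sub_succ_of_antitone {ρ : ℕ → ℝ} (hρ : Antitone ρ) (h0 : ∀ k, 0 ≤ ρ k) :
    Summable fun k => ρ k - ρ (k + 1) :=
  summable_of_sum_range_le (fun k => sub_nonneg.2 (hρ k.le_succ)) (c := ρ 0) fun n => by
    rw [Finset.sum_range_sub']
    linarith [h0 n]

theorem eventually_eq_of_tendsto_of_finite {u : ℕ → ℝ} {S : Set ℝ} {a : ℝ} (hS : S.Finite)
    (hu : Filter.Tendsto u Filter.atTop (𝓝 a)) (huS : ∀ᶠ k in Filter.atTop, u k ∈ S) :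
    ∀ᶠ k in Filter.atTop, u k = a := by
  have h1 : ∀ᶠ y in 𝓝 a, y ∉ S \ {a} :=
    (hS.subset Set.sdiff_subset).isClosed.isOpen_compl.mem_nhds (by simp)
  filter_upwards [hu.eventually h1, huS] with k hk hkS
  by_contra hne
  exact hk ⟨hkS, hne⟩

theorem exists_gap {S : Set ℝ} (hS : S.Finite) (m : ℝ) :
    ∃ γ : ℝ, 0 < γ ∧ ∀ s ∈ S, s < m + γ → s ≤ m := by
  have : ∀ᶠ γ : ℝ in 𝓝[>] 0, ∀ s ∈ S, s < m + γ → s ≤ m := by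
    rw [Filter.eventually_all_finite hS]
    intro s _
    by_cases hs : s ≤ m
    · simp [hs]
    · filter_upwards [nhdsWithin_le_nhds (eventually_lt_nhds (sub_pos.2 (not_le.1 hs)))] with γ hγ h
      linarith
  obtain ⟨γ, hγ, h0⟩ := (this.and self_mem_nhdsWithin).exists
  exact ⟨γ, h0, hγ⟩

end Scalar

/-! ### Consequences of one proximal sweep. -/

section Descent

variable {E : Type*} [NormedAddCommGroup E] [InnerProductSpace ℝ E]
  (L : E →L[ℝ] ℝ) (A : E →L[ℝ] E →L[ℝ] ℝ)

/-- The variational inequality for the exact solution `y` of one sweep of block problems with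
proximal parameter `σ`, where `z` and `z'` are the iterates before and after the sweep. -/
def IsProxStep (σ : ℝ) (P : Set E) (z z' y : E) : Prop :=
  y ∈ P ∧ ∀ w ∈ P, 0 ≤ L (w - y) + A z' (w - y) + A (w - y) z + σ * inner ℝ (y - z) (w - y)

variable {L A} {σ : ℝ} {P : Set E}

/-- Test the inequality with `x`. As `z'` and `z` sit in opposite slots of `A`, replacing them by
`y` and `x` reproduces the energy difference exactly, with no `A (y - x) (y - x)` left over for `σ`
to dominate. -/
theorem IsProxStep.quad_sub_le (hσ : 0 ≤ σ) {z z' y x : E} (h : IsProxStep L A σ P z z' y)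
    (hx : x ∈ P) : quad L A y - quad L A x ≤
      (‖A‖ + σ) * (‖y - z'‖ + ‖x - z‖) * ‖y - x‖ - σ * ‖y - x‖ ^ 2 := by
  have hVI := h.2 x hx
  have hin : inner ℝ (y - z) (x - y) ≤ ‖x - z‖ * ‖y - x‖ - ‖y - x‖ ^ 2 := by
    have h1 : y - z = (x - z) - (x - y) := by abel
    have h2 := real_inner_le_norm (x - z) (x - y)
    rw [h1, inner_sub_left, real_inner_self_eq_norm_sq, norm_sub_rev y x]
    linarith
  have hin' := mul_le_mul_of_nonneg_left hin hσ
  have h1 := (abs_le.1 (abs_le_opNorm₂ A (y - z') (y - x))).2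
  have h2 := (abs_le.1 (abs_le_opNorm₂ A (y - x) (x - z))).2
  have h3 : 0 ≤ σ * ‖y - z'‖ * ‖y - x‖ := by positivity
  have h4 : quad L A y - quad L A x = -(L (x - y) + A z' (x - y) + A (x - y) z) +
      A (y - z') (y - x) + A (y - x) (x - z) := by
    simp only [quad, map_sub, sub_apply]
    ring
  rw [h4]
  nlinarith

theorem IsProxStep.le_slope (hσ : 0 ≤ σ) {z z' y : E} (h : IsProxStep L A σ P z z' y) (x : E)
    {w : E} (hw : w ∈ P) :
    -((‖A‖ + σ) * (‖y - x‖ + (‖y - z'‖ + ‖x - z‖)) * ‖w - y‖) ≤ slope L A y (w - y) := by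
  have hVI := h.2 w hw
  have h1 := (abs_le.1 (abs_le_opNorm₂ A (y - z') (w - y))).1
  have h2 := (abs_le.1 (abs_le_opNorm₂ A (w - y) (y - z))).1
  have h3 := mul_le_mul_of_nonneg_left (real_inner_le_norm (y - z) (w - y)) hσ
  have h4 : ‖y - z‖ ≤ ‖y - x‖ + ‖x - z‖ := norm_sub_le_norm_sub_add_norm_sub y x z
  have h5 : 0 ≤ σ * ‖y - z'‖ * ‖w - y‖ := by positivity
  have h6 : (‖A‖ + σ) * ‖y - z‖ * ‖w - y‖ ≤ (‖A‖ + σ) * (‖y - x‖ + ‖x - z‖) * ‖w - y‖ := by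
    gcongr
  have h7 : slope L A y (w - y) = (L (w - y) + A z' (w - y) + A (w - y) z) +
      A (y - z') (w - y) + A (w - y) (y - z) := by
    simp only [slope_apply, map_sub, sub_apply]
    ring
  rw [h7]
  linarith

/-- Expanding around each of the two points, (near-)criticality bounds the first-order term from
below, by a quantity of order `s ^ 2`; the quadratic remainder has the same order. -/
theorem IsCritical.abs_quad_sub_le {x x' : E} {s κ : ℝ} (h : IsCritical L A P x')
    (hs : 0 ≤ s) (hκ : 0 ≤ κ) (hxx' : ‖x - x'‖ ≤ κ * s) (hxP : x ∈ P)
    (hx : ∀ w ∈ P, -(s * ‖w - x‖) ≤ slope L A x (w - x)) :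
    |quad L A x - quad L A x'| ≤ (κ + ‖A‖ * κ ^ 2) * s ^ 2 := by
  have h1 := quad_sub_quad L A x x'
  have h2 := quad_sub_quad L A x' x
  have h3 := h.2 x hxP
  have h4 := hx x' h.1
  have h5 := (abs_le.1 (abs_le_opNorm₂ A (x - x') (x - x'))).1
  have h6 := (abs_le.1 (abs_le_opNorm₂ A (x' - x) (x' - x))).1
  rw [norm_sub_rev x' x] at h4 h6
  have h7 : s * ‖x - x'‖ ≤ s * (κ * s) := by gcongr
  have h8 : ‖A‖ * ‖x - x'‖ * ‖x - x'‖ ≤ ‖A‖ * (κ * s) * (κ * s) := by gcongr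
  have h9 : 0 ≤ s * (κ * s) := by positivity
  rw [abs_le]
  constructor <;> nlinarith

end Descent

/-! ### Summability of the steps and convergence. -/

section Convergence

variable {E : Type*} [NormedAddCommGroup E] [InnerProductSpace ℝ E]
  {L : E →L[ℝ] ℝ} {A : E →L[ℝ] E →L[ℝ] ℝ} {σ : ℝ} {P : Set E}

/-- The steps of an inexact proximal descent with non-increasing energies are summable. -/
theorem summable_norm_sub_of_isProxStep (hP : IsPolyhedron P) (hc : IsCompact P) (hσ : 0 < σ)
    {z x : ℕ → E} (hstep : ∀ k, IsProxStep L A σ P (z k) (z (k + 1)) (x (k + 1)))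
    (hx0 : x 0 ∈ P) (hanti : Antitone fun k => quad L A (x k))
    (hsum : Summable fun k => ‖x k - z k‖) : Summable fun k => ‖x (k + 1) - x k‖ := by
  have hxP : ∀ k, x k ∈ P := fun k => k.casesOn hx0 fun k => (hstep k).1
  set q : ℕ → ℝ := fun k => quad L A (x k) with hq
  set d : ℕ → ℝ := fun k => ‖x (k + 1) - x k‖ with hd
  set ε : ℕ → ℝ := fun k => ‖x (k + 1) - z (k + 1)‖ + ‖x k - z k‖ with hε
  have hd0 : ∀ k, 0 ≤ d k := fun k => norm_nonneg _
  have hε0 : ∀ k, 0 ≤ ε k := fun k => by positivity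
  have hεsum : Summable ε := ((summable_nat_add_iff 1).2 hsum).add hsum
  set M : ℝ := ‖A‖ + σ with hM
  have hM0 : 0 < M := by positivity
  set s : ℕ → ℝ := fun k => M * (d k + ε k) with hs
  have hs0 : ∀ k, 0 ≤ s k := fun k => mul_nonneg hM0.le (add_nonneg (hd0 k) (hε0 k))
  have hdesc : ∀ k, d k ^ 2 ≤ (q k - q (k + 1)) / σ + M / σ * ε k * d k := fun k => by
    have h1 : q (k + 1) - q k ≤ M * ε k * d k - σ * d k ^ 2 :=
      (hstep k).quad_sub_le hσ.le (hxP k)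
    have h2 : (q k - q (k + 1)) / σ + M / σ * ε k * d k
        = (q k - q (k + 1) + M * ε k * d k) / σ := by ring
    rw [h2, le_div_iff₀ hσ]
    linarith
  have hres : ∀ k, ∀ w ∈ P, -(s k * ‖w - x (k + 1)‖) ≤ slope L A (x (k + 1)) (w - x (k + 1)) :=
    fun k w hw => (hstep k).le_slope hσ.le (x k) hw
  obtain ⟨F, hF⟩ : ∃ F, Filter.Tendsto q Filter.atTop (𝓝 F) :=
    ⟨_, tendsto_atTop_ciInf hanti ((hc.image (continuous_quad L A)).bddBelow.mono (by
      rintro _ ⟨k, rfl⟩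
      exact ⟨x k, hxP k, rfl⟩))⟩
  have hFq : ∀ k, F ≤ q k := fun k => hanti.le_of_tendsto hF k
  have hεlim := hεsum.tendsto_atTop_zero
  have hdlim : Filter.Tendsto d Filter.atTop (𝓝 0) := by
    have hle : ∀ k, d k ≤ √((q k - q (k + 1)) / σ) + M / σ * ε k := fun k => by
      refine le_add_of_sq_le (Real.sqrt_nonneg _) (mul_nonneg (by positivity) (hε0 k)) ?_
      rw [Real.sq_sqrt (div_nonneg (sub_nonneg.2 (hanti k.le_succ)) hσ.le)]
      exact hdesc k
    refine squeeze_zero hd0 hle ?_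
    have h1 := ((hF.sub ((Filter.tendsto_add_atTop_iff_nat 1).2 hF)).div_const σ).sqrt
    simpa using h1.add (hεlim.const_mul (M / σ))
  have hslim : Filter.Tendsto s Filter.atTop (𝓝 0) := by
    simpa using (hdlim.add hεlim).const_mul M
  obtain ⟨κ, hκ, S, hS, hnear⟩ := exists_isCritical_near L A hP hc
  have hu : ∀ k, ∃ u, κ * s k < 1 → IsCritical L A P u ∧ ‖x (k + 1) - u‖ ≤ κ * s k ∧
      quad L A u ∈ S := fun k => by
    by_cases h : κ * s k < 1
    · obtain ⟨u, hu⟩ := hnear _ (hxP (k + 1)) (s k) (hs0 k) h (hres k)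
      exact ⟨u, fun _ => hu⟩
    -- A dummy value where the residual is too large, which happens only finitely often.
    · exact ⟨0, fun h' => absurd h' h⟩
  choose u hu using hu
  have hsmall : ∀ᶠ k in Filter.atTop, κ * s k < 1 := by
    have := hslim.const_mul κ
    rw [mul_zero] at this
    exact this.eventually_lt_const one_pos
  set κ' : ℝ := κ + ‖A‖ * κ ^ 2 with hκ'
  have hκ'0 : 0 ≤ κ' := by positivity
  have habs : ∀ᶠ k in Filter.atTop, |q (k + 1) - quad L A (u k)| ≤ κ' * s k ^ 2 := by
    filter_upwards [hsmall] with k hk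
    exact (hu k hk).1.abs_quad_sub_le (hs0 k) hκ (hu k hk).2.1 (hxP _) (hres k)
  have hulim : Filter.Tendsto (fun k => quad L A (u k)) Filter.atTop (𝓝 F) := by
    have h1 : Filter.Tendsto (fun k => q (k + 1) - quad L A (u k)) Filter.atTop (𝓝 0) := by
      refine squeeze_zero_norm' habs ?_
      simpa using (hslim.pow 2).const_mul κ'
    simpa using ((Filter.tendsto_add_atTop_iff_nat 1).2 hF).sub h1
  -- The nearby critical values converge to `F` inside a finite set, hence eventually equal `F`; the
  -- second-order bound then becomes the Łojasiewicz inequality `hρs`.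
  have hueq := eventually_eq_of_tendsto_of_finite hS hulim (by
    filter_upwards [hsmall] with k hk using (hu k hk).2.2)
  set ρ : ℕ → ℝ := fun k => √(q k - F) with hρ
  have hρ0 : ∀ k, 0 ≤ ρ k := fun k => Real.sqrt_nonneg _
  have hρsq : ∀ k, ρ k ^ 2 = q k - F := fun k => Real.sq_sqrt (sub_nonneg.2 (hFq k))
  have hρanti : Antitone ρ := fun i j hij => Real.sqrt_le_sqrt (sub_le_sub_right (hanti hij) F)
  have hρs : ∀ᶠ k in Filter.atTop, ρ (k + 1) ≤ (1 + κ') * s k := by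
    filter_upwards [habs, hueq] with k h1 h2
    rw [h2] at h1
    refine Real.sqrt_le_iff.2 ⟨mul_nonneg (by positivity) (hs0 k), ?_⟩
    have h3 := (abs_le.1 h1).2
    have h4 : 0 ≤ s k ^ 2 := sq_nonneg _
    have h5 : 0 ≤ κ' ^ 2 * s k ^ 2 := by positivity
    have h6 : 0 ≤ κ' * s k ^ 2 := by positivity
    nlinarith
  -- Chosen so that the energy decrease over `σ` is at most `2ab` with `a = (d k + ε k) / 2` and `b
  -- = c * (ρ (k + 1) - ρ (k + 2))`. Then `2ab ≤ (a + b)²` gives a recursion with factor 1/2 and a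
  -- telescoping term.
  set c : ℝ := 2 * M * (1 + κ') / σ with hcdef
  have hc0 : 0 ≤ c := by positivity
  have hrec : ∀ᶠ k in Filter.atTop, d (k + 1) ≤
      d k / 2 + (ε k / 2 + c * (ρ (k + 1) - ρ (k + 1 + 1)) + M / σ * ε (k + 1)) := by
    filter_upwards [hρs] with k hk
    have hΔ : 0 ≤ ρ (k + 1) - ρ (k + 1 + 1) := sub_nonneg.2 (hρanti (k + 1).le_succ)
    have hde : 0 ≤ d k + ε k := add_nonneg (hd0 k) (hε0 k)
    have h1 : (q (k + 1) - q (k + 1 + 1)) / σ ≤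
        2 * ((d k + ε k) / 2) * (c * (ρ (k + 1) - ρ (k + 1 + 1))) := by
      have h2 : q (k + 1) - q (k + 1 + 1) ≤ 2 * ρ (k + 1) * (ρ (k + 1) - ρ (k + 1 + 1)) := by
        nlinarith [hρsq (k + 1), hρsq (k + 1 + 1)]
      have h3 : 2 * ρ (k + 1) * (ρ (k + 1) - ρ (k + 1 + 1)) ≤
          2 * ((1 + κ') * s k) * (ρ (k + 1) - ρ (k + 1 + 1)) := by gcongr
      rw [div_le_iff₀ hσ]
      refine (h2.trans h3).trans_eq ?_
      rw [hcdef]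
      simp only [hs]
      field_simp
    have h4 := le_add_of_sq_le (d := d (k + 1))
      (c := (d k + ε k) / 2 + c * (ρ (k + 1) - ρ (k + 1 + 1)))
      (b := M / σ * ε (k + 1)) (add_nonneg (by positivity) (mul_nonneg hc0 hΔ))
      (mul_nonneg (by positivity) (hε0 _)) (by
        have h5 := hdesc (k + 1)
        have h6 := sq_nonneg ((d k + ε k) / 2)
        have h7 := sq_nonneg (c * (ρ (k + 1) - ρ (k + 1 + 1)))
        rw [add_sq]
        linarith)
    linarith
  obtain ⟨k₀, hk₀⟩ := Filter.eventually_atTop.1 hrec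
  have ha : Summable fun k => ε k / 2 + c * (ρ (k + 1) - ρ (k + 1 + 1)) + M / σ * ε (k + 1) :=
    ((hεsum.div_const 2).add (((summable_nat_add_iff 1).2
      (summable_sub_succ_of_antitone hρanti hρ0)).mul_left c)).add
      (((summable_nat_add_iff 1).2 hεsum).mul_left (M / σ))
  refine (summable_nat_add_iff k₀).1 (summable_of_le_half_add (d := fun k => d (k + k₀))
    (fun k => hd0 _) ((summable_nat_add_iff k₀).2 ha) (fun k => ?_) fun k => ?_)
  · have hΔ := mul_nonneg hc0 (sub_nonneg.2 (hρanti (k + k₀ + 1).le_succ))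
    have h1 := hε0 (k + k₀)
    have h2 := mul_nonneg (div_nonneg hM0.le hσ.le) (hε0 (k + k₀ + 1))
    exact add_nonneg (add_nonneg (by positivity) hΔ) h2
  · have := hk₀ (k + k₀) (Nat.le_add_left _ _)
    rwa [show k + 1 + k₀ = k + k₀ + 1 by ring]

/-- Inexact proximal descent with non-increasing energies converges to a critical point. -/
theorem exists_tendsto_of_isProxStep [CompleteSpace E] (hP : IsPolyhedron P)
    (hc : IsCompact P) (hσ : 0 < σ)
    {z x : ℕ → E} (hstep : ∀ k, IsProxStep L A σ P (z k) (z (k + 1)) (x (k + 1)))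
    (hanti : Antitone fun k => quad L A (x (k + 1)))
    (hsum : Summable fun k => ‖x (k + 1) - z (k + 1)‖) :
    ∃ y, IsCritical L A P y ∧ quad L A y ≤ quad L A (x 1) ∧ Filter.Tendsto z Filter.atTop (𝓝 y) := by
  -- Shifted by one, since `x 0` is arbitrary and `x 1` is the first point known to lie in `P`.
  have hd := summable_norm_sub_of_isProxStep hP hc hσ (z := fun k => z (k + 1))
    (x := fun k => x (k + 1)) (fun k => hstep (k + 1)) (hstep 0).1 hanti hsum
  obtain ⟨y, hy⟩ := cauchySeq_tendsto_of_complete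
    (cauchySeq_of_summable_dist (f := fun k => x (k + 1)) (by
      simpa only [dist_eq_norm, norm_sub_rev] using hd))
  have hε : Filter.Tendsto (fun k => x (k + 1) - z (k + 1)) Filter.atTop (𝓝 0) :=
    tendsto_zero_iff_norm_tendsto_zero.2 hsum.tendsto_atTop_zero
  have hz : Filter.Tendsto (fun k => z (k + 1)) Filter.atTop (𝓝 y) := by
    simpa using hy.sub hε
  have hyP : y ∈ P := hc.isClosed.mem_of_tendsto hy (.of_forall fun k => (hstep k).1)
  refine ⟨y, ⟨hyP, fun w hw => ?_⟩, ?_, (Filter.tendsto_add_atTop_iff_nat 1).1 hz⟩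
  · have hy' := (Filter.tendsto_add_atTop_iff_nat 1).2 hy
    have hz' := (Filter.tendsto_add_atTop_iff_nat 1).2 hz
    have hcont : Continuous fun p : E × E × E =>
        L (w - p.1) + A p.2.2 (w - p.1) + A (w - p.1) p.2.1 + σ * inner ℝ (p.1 - p.2.1) (w - p.1) := by
      fun_prop
    have hlim := (hcont.tendsto (y, y, y)).comp (hy'.prodMk_nhds (hz.prodMk_nhds hz'))
    have := ge_of_tendsto' hlim fun k => (hstep (k + 1)).2 w hw
    simpa [slope_apply] using this
  · exact hanti.le_of_tendsto (((continuous_quad L A).tendsto y).comp hy) 0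

/-- Started near a global minimizer and with small total error, inexact proximal descent with
non-increasing energies converges to a global minimizer. -/
theorem exists_tendsto_minimizer_of_isProxStep [CompleteSpace E] (L : E →L[ℝ] ℝ)
    (A : E →L[ℝ] E →L[ℝ] ℝ)
    (hP : IsPolyhedron P) (hc : IsCompact P) (hσ : 0 < σ) :
    ∃ η : ℝ, 0 < η ∧ ∃ δ : ℝ, 0 < δ ∧ ∀ z x : ℕ → E,
      (∀ k, IsProxStep L A σ P (z k) (z (k + 1)) (x (k + 1))) →
      (Antitone fun k => quad L A (x (k + 1))) →
      (Summable fun k => ‖x (k + 1) - z (k + 1)‖) →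
      ∑' k, ‖x (k + 1) - z (k + 1)‖ < η → z 0 ∈ P →
      (∃ o ∈ P, (∀ w ∈ P, quad L A o ≤ quad L A w) ∧ ‖z 0 - o‖ < δ) →
      ∃ y ∈ P, (∀ w ∈ P, quad L A y ≤ quad L A w) ∧ Filter.Tendsto z Filter.atTop (𝓝 y) := by
  obtain ⟨κ, hκ, S, hS, hnear⟩ := exists_isCritical_near L A hP hc
  obtain ⟨γ, hγ, hgap⟩ := exists_gap hS (sInf (quad L A '' P))
  obtain ⟨R, hR⟩ := hc.isBounded.exists_norm_le
  obtain ⟨δ, hδ, hδγ⟩ := Metric.uniformContinuousOn_iff.1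
    (hc.uniformContinuousOn_of_continuous (continuous_quad L A).continuousOn) (γ / 2) (half_pos hγ)
  set D : ℝ := (‖A‖ + σ) * (1 + 2 * |R|) with hD
  have hD0 : 0 < D := by positivity
  -- Half of the gap `γ` pays for the energy of `z 0` above the minimum, half for the possible
  -- increase `D * ‖x 1 - z 1‖` in the first sweep.
  refine ⟨γ / 2 / D, by positivity, δ, hδ, fun z x hstep hanti hsum hη hz0 ⟨o, ho, hmin, hoz⟩ => ?_⟩
  obtain ⟨y, hy, hyx, hlim⟩ := exists_tendsto_of_isProxStep hP hc hσ hstep hanti hsum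
  have hinf : sInf (quad L A '' P) = quad L A o :=
    IsLeast.csInf_eq ⟨⟨o, ho, rfl⟩, by rintro _ ⟨w, hw, rfl⟩; exact hmin w hw⟩
  -- With residual 0 the error bound returns `y` itself, so the value at `y` is one of the finitely
  -- many in `S`.
  obtain ⟨y', -, hyy', hyS⟩ := hnear y hy.1 0 le_rfl (by simp) (by simpa using hy.2)
  rw [mul_zero, norm_le_zero_iff, sub_eq_zero] at hyy'
  subst hyy'
  refine ⟨y, hy.1, fun w hw => le_trans ?_ (hmin w hw), hlim⟩
  rw [← hinf]
  refine hgap _ hyS (hyx.trans_lt ?_)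
  rw [hinf]
  have h1 : quad L A (z 0) - quad L A o < γ / 2 :=
    (abs_lt.1 (hδγ _ hz0 _ ho (by rwa [dist_eq_norm]))).2
  -- The feasible `z 0` is its own comparison point, so only the error of the first sweep enters.
  have h2 := (hstep 0).quad_sub_le hσ.le hz0
  have h3 : ‖x 1 - z 1‖ < γ / 2 / D :=
    (hsum.le_tsum 0 fun k _ => norm_nonneg _).trans_lt hη
  have h4 : ‖x 1 - z 0‖ ≤ 1 + 2 * |R| := by
    have h1 := hR _ (hstep 0).1
    have h2 := hR _ hz0
    have h3 := norm_sub_le (x 1) (z 0)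
    have h4 := le_abs_self R
    simp only [zero_add] at h1
    linarith
  have h5 : (‖A‖ + σ) * ‖x 1 - z 1‖ * ‖x 1 - z 0‖ ≤ D * ‖x 1 - z 1‖ := by
    calc _ ≤ (‖A‖ + σ) * ‖x 1 - z 1‖ * (1 + 2 * |R|) := by gcongr
      _ = _ := by rw [hD]; ring
  have h6 : D * ‖x 1 - z 1‖ < γ / 2 := by rwa [lt_div_iff₀' hD0] at h3
  have h7 : 0 ≤ σ * ‖x 1 - z 0‖ ^ 2 := by positivity
  simp only [zero_add, sub_self, norm_zero, add_zero] at h2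
  linarith

end Convergence

/-! ### Block structure of the energy, block optimality and multipliers. -/

section Blockwise

variable {n K : ℕ}

theorem matInner_eq_sum (A B : Matrix (Fin K) (Fin K) ℝ) :
    matInner A B = ∑ j, ∑ k, A j k * B j k := by
  rw [matInner, Matrix.trace, Finset.sum_comm]
  simp [Matrix.mul_apply]

theorem frobNorm_sq (A : Matrix (Fin K) (Fin K) ℝ) : frobNorm A ^ 2 = matInner A A := by
  rw [frobNorm, Real.sq_sqrt (by positivity), matInner_eq_sum]
  simp only [sq]

theorem matInner_add_left (A B C : Matrix (Fin K) (Fin K) ℝ) :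
    matInner (A + B) C = matInner A C + matInner B C := by
  simp [matInner, add_mul]

theorem matInner_add_right (A B C : Matrix (Fin K) (Fin K) ℝ) :
    matInner A (B + C) = matInner A B + matInner A C := by
  simp [matInner, mul_add]

theorem matInner_smul_left (t : ℝ) (A B : Matrix (Fin K) (Fin K) ℝ) :
    matInner (t • A) B = t * matInner A B := by
  simp [matInner]

theorem matInner_smul_right (t : ℝ) (A B : Matrix (Fin K) (Fin K) ℝ) :
    matInner A (t • B) = t * matInner A B := by
  simp [matInner]

variable (e ϱ : Fin K → ℝ) (c : Matrix (Fin K) (Fin K) ℝ) (β σ : ℝ)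

/-- The coupling of two blocks in the penalized energy. -/
noncomputable def coupling : Matrix (Fin K) (Fin K) ℝ →ₗ[ℝ] Matrix (Fin K) (Fin K) ℝ →ₗ[ℝ] ℝ :=
  LinearMap.mk₂ ℝ
    (fun X Y => matInner X (Matrix.diagonal e * Matrix.diagonal ϱ * Y *
      Matrix.diagonal e * interaction c * Matrix.diagonal e) + β * matInner X Y)
    (fun X X' Y => by simp only [matInner_add_left]; ring)
    (fun t X Y => by simp only [matInner_smul_left, smul_eq_mul]; ring)
    (fun X Y Y' => by simp only [mul_add, add_mul, matInner_add_right]; ring)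
    (fun t X Y => by
      simp only [Matrix.mul_smul, Matrix.smul_mul, matInner_smul_right, smul_eq_mul]; ring)

/-- The linear part of the penalized energy. -/
noncomputable def linearPart : Blocks n K →ₗ[ℝ] ℝ where
  toFun Z := ∑ i, matInner (Z i)
    (Matrix.diagonal ϱ * Matrix.diagonal e * interaction c * Matrix.diagonal e)
  map_add' Z W := by simp [matInner_add_left, Finset.sum_add_distrib]
  map_smul' t Z := by simp [matInner_smul_left, Finset.mul_sum]

/-- The bilinear form `(Z, W) ↦ ∑_{i<j} b(Z_i, W_j)`, where `b` couples two blocks. -/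
noncomputable def crossPart : Blocks n K →ₗ[ℝ] Blocks n K →ₗ[ℝ] ℝ :=
  LinearMap.mk₂ ℝ (fun Z W => ∑ i, ∑ j ∈ Finset.Ioi i, coupling e ϱ c β (Z i) (W j))
    (fun Z Z' W => by simp [Finset.sum_add_distrib])
    (fun t Z W => by simp [Finset.mul_sum])
    (fun Z W W' => by simp [Finset.sum_add_distrib])
    (fun t Z W => by simp [Finset.mul_sum])

theorem crossPart_apply (Z W : Blocks n K) :
    crossPart e ϱ c β Z W = ∑ i, ∑ j ∈ Finset.Ioi i, coupling e ϱ c β (Z i) (W j) := rfl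

theorem penalized_eq (Z : Blocks n K) :
    penalized e ϱ c β Z = linearPart e ϱ c Z + crossPart e ϱ c β Z Z := by
  simp only [penalized, energy, linearPart, crossPart, coupling, LinearMap.mk₂_apply,
    LinearMap.coe_mk, AddHom.coe_mk, Finset.sum_add_distrib, Finset.mul_sum]
  ring

/-- Only pairs `i < j` are coupled, so the energy is affine in each block separately. -/
theorem crossPart_single_single (i : Fin n) (H H' : Matrix (Fin K) (Fin K) ℝ) :
    crossPart e ϱ c β (Pi.single i H) (Pi.single i H') = 0 := by
  rw [crossPart_apply]
  refine Finset.sum_eq_zero fun a _ => Finset.sum_eq_zero fun b hb => ?_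
  have hab : a < b := Finset.mem_Ioi.1 hb
  by_cases ha : a = i
  · subst ha
    rw [Pi.single_eq_of_ne hab.ne', map_zero]
  · rw [Pi.single_eq_of_ne ha, map_zero, LinearMap.zero_apply]

/-- Blocks coupled to `i` through the first slot precede `i`, so only updated ones count; dually,
`crossPart_single_splice` sees only the old ones. -/
theorem crossPart_splice_single (Y Z : Blocks n K) (i : Fin n)
    (X H : Matrix (Fin K) (Fin K) ℝ) :
    crossPart e ϱ c β (splice Y Z i X) (Pi.single i H) = crossPart e ϱ c β Y (Pi.single i H) := by
  simp only [crossPart_apply]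
  refine Finset.sum_congr rfl fun a _ => Finset.sum_congr rfl fun b hb => ?_
  have hab : a < b := Finset.mem_Ioi.1 hb
  by_cases hb : b = i
  · subst hb
    simp [splice, hab]
  · simp [Pi.single_eq_of_ne hb]

theorem crossPart_single_splice (Y Z : Blocks n K) (i : Fin n)
    (X H : Matrix (Fin K) (Fin K) ℝ) :
    crossPart e ϱ c β (Pi.single i H) (splice Y Z i X) = crossPart e ϱ c β (Pi.single i H) Z := by
  simp only [crossPart_apply]
  refine Finset.sum_congr rfl fun a _ => Finset.sum_congr rfl fun b hb => ?_
  have hab : a < b := Finset.mem_Ioi.1 hb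
  by_cases ha : a = i
  · subst ha
    simp [splice, hab.not_gt, hab.ne']
  · simp [Pi.single_eq_of_ne ha]

theorem splice_add_smul (Y Z : Blocks n K) (i : Fin n) (X H : Matrix (Fin K) (Fin K) ℝ) (t : ℝ) :
    splice Y Z i (X + t • H) =
    splice Y Z i X + t • (Pi.single i H : Blocks n K) := by
  funext j
  rcases lt_trichotomy j i with h | h | h
  · simp [splice, h, Pi.single_eq_of_ne h.ne]
  · subst h
    simp [splice]
  · simp [splice, h.not_gt, h.ne']

theorem penalized_add_smul_single (Z : Blocks n K) (i : Fin n) (H : Matrix (Fin K) (Fin K) ℝ)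
    (t : ℝ) :
    penalized e ϱ c β (Z + t • (Pi.single i H : Blocks n K)) = penalized e ϱ c β Z +
      t * (linearPart e ϱ c (Pi.single i H : Blocks n K) + crossPart e ϱ c β Z (Pi.single i H) +
        crossPart e ϱ c β (Pi.single i H) Z) := by
  simp only [penalized_eq, map_add, map_smul, LinearMap.add_apply, LinearMap.smul_apply,
    smul_eq_mul, crossPart_single_single]
  ring

theorem nonneg_of_forall_mem_Ioc {a b : ℝ} (h : ∀ t, 0 < t → t ≤ 1 → 0 ≤ t * a + t ^ 2 * b) :
    0 ≤ a := by
  have hc : Continuous fun t : ℝ => a + t * b := by fun_prop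
  have h0 := hc.tendsto 0
  simp only [zero_mul, add_zero] at h0
  refine ge_of_tendsto (h0.mono_left (nhdsWithin_le_nhds (s := Set.Ioi 0))) ?_
  filter_upwards [self_mem_nhdsWithin, nhdsWithin_le_nhds (Iic_mem_nhds one_pos)] with t ht ht1
  have ht : 0 < t := ht
  refine nonneg_of_mul_nonneg_right ?_ ht
  have := h t ht ht1
  linarith

theorem isPolyhedron_feasibleBlock : IsPolyhedron (feasibleBlock e ϱ) := by
  simp only [feasibleBlock, funext_iff]
  refine .and (.forall fun j => .eq ⟨fun X Y => ?_, fun t X => ?_⟩ _)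
    (.and (.forall fun j => .eq ⟨fun X Y => ?_, fun t X => ?_⟩ _)
    (.and (.eq ⟨fun X Y => Matrix.trace_add X Y, fun t X => Matrix.trace_smul t X⟩ _)
      (.forall fun j => .forall fun k => .ge ⟨fun _ _ => rfl, fun _ _ => rfl⟩ _)))
  · simp [Matrix.add_mulVec]
  · simp [Matrix.smul_mulVec]
  · simp only [Matrix.transpose_add, Matrix.add_mulVec, Pi.add_apply]
  · simp only [Matrix.transpose_smul, Matrix.smul_mulVec, Pi.smul_apply]

theorem IsPolyhedron.preimage {E F : Type*} [AddCommGroup E] [Module ℝ E] [AddCommGroup F]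
    [Module ℝ F] {P : Set F} (hP : IsPolyhedron P) (f : E →ₗ[ℝ] F) : IsPolyhedron (f ⁻¹' P) := by
  obtain ⟨T, hT, rfl⟩ := hP
  refine ⟨(fun p => (p.1.comp f, p.2)) '' T, hT.image _, ?_⟩
  ext x
  rw [Set.mem_ofPred_eq, Set.forall_mem_image]
  rfl

theorem isPolyhedron_feasible : IsPolyhedron (feasible (n := n) e ϱ) :=
  .forall fun i => (isPolyhedron_feasibleBlock e ϱ).preimage
    (LinearMap.proj i : Blocks n K →ₗ[ℝ] Matrix (Fin K) (Fin K) ℝ)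

variable {e ϱ c β σ} in
/-- First-order optimality of a proximal block solution. -/
theorem blockObjective_variational {Y Z : Blocks n K} {i : Fin n} {X : Matrix (Fin K) (Fin K) ℝ}
    (hX : X ∈ feasibleBlock e ϱ) (hmin : ∀ W ∈ feasibleBlock e ϱ,
      blockObjective e ϱ c β σ Y Z i X ≤ blockObjective e ϱ c β σ Y Z i W)
    {W : Matrix (Fin K) (Fin K) ℝ} (hW : W ∈ feasibleBlock e ϱ) :
    0 ≤ linearPart e ϱ c (Pi.single i (W - X) : Blocks n K) +
      crossPart e ϱ c β Y (Pi.single i (W - X)) + crossPart e ϱ c β (Pi.single i (W - X)) Z +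
      σ * matInner (X - Z i) (W - X) := by
  refine nonneg_of_forall_mem_Ioc (b := σ / 2 * matInner (W - X) (W - X)) fun t ht ht1 => ?_
  have h := hmin _ ((isPolyhedron_feasibleBlock e ϱ).convex.add_smul_sub_mem hX hW ⟨ht.le, ht1⟩)
  have hsymm : matInner (W - X) (X - Z i) = matInner (X - Z i) (W - X) := by
    simp only [matInner_eq_sum, mul_comm]
  rw [blockObjective, blockObjective, splice_add_smul, penalized_add_smul_single,
    crossPart_splice_single, crossPart_single_splice, frobNorm_sq, frobNorm_sq, add_sub_right_comm,
    matInner_add_left, matInner_add_right, matInner_add_right, matInner_smul_left,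
    matInner_smul_left, matInner_smul_right, matInner_smul_right, hsymm] at h
  linarith

theorem blockGradient_apply (Z : Blocks n K) (i : Fin n) (j k : Fin K) :
    blockGradient e ϱ c β Z i j k =
      linearPart e ϱ c (Pi.single i (Matrix.single j k 1) : Blocks n K) +
        crossPart e ϱ c β Z (Pi.single i (Matrix.single j k 1)) +
        crossPart e ϱ c β (Pi.single i (Matrix.single j k 1)) Z := by
  have h : ∀ t : ℝ, Function.update Z i (Z i + t • Matrix.single j k (1 : ℝ)) =
      Z + t • (Pi.single i (Matrix.single j k 1) : Blocks n K) := fun t => by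
    funext a
    by_cases ha : a = i
    · subst ha; simp
    · simp [ha]
  simp only [blockGradient, Matrix.of_apply, h, penalized_add_smul_single]
  simp

variable {e ϱ} in
/-- Multipliers for a linear program over `feasibleBlock`. -/
theorem exists_multipliers {X : Matrix (Fin K) (Fin K) ℝ} (hX : X ∈ feasibleBlock e ϱ)
    (g : Matrix (Fin K) (Fin K) ℝ →ₗ[ℝ] ℝ) (hg : ∀ W ∈ feasibleBlock e ϱ, 0 ≤ g (W - X)) :
    ∃ (u v : Fin K → ℝ) (w : ℝ) (Φ : Matrix (Fin K) (Fin K) ℝ), (∀ j k, 0 ≤ Φ j k) ∧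
      matInner Φ X = 0 ∧ (Matrix.of fun j k => g (Matrix.single j k 1)) =
        Matrix.vecMulVec u e + Matrix.vecMulVec ((Matrix.diagonal e).mulVec ϱ) v +
          w • (1 : Matrix (Fin K) (Fin K) ℝ) + Φ := by
  classical
  let row : Fin K → Matrix (Fin K) (Fin K) ℝ →ₗ[ℝ] ℝ := fun j =>
    { toFun := fun d => d.mulVec e j
      map_add' := fun d d' => by simp [Matrix.add_mulVec]
      map_smul' := fun t d => by simp [Matrix.smul_mulVec] }
  let col : Fin K → Matrix (Fin K) (Fin K) ℝ →ₗ[ℝ] ℝ := fun k =>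
    { toFun := fun d => d.transpose.mulVec ((Matrix.diagonal e).mulVec ϱ) k
      map_add' := fun d d' => by
        simp only [Matrix.transpose_add, Matrix.add_mulVec, Pi.add_apply]
      map_smul' := fun t d => by
        simp only [Matrix.transpose_smul, Matrix.smul_mulVec, Pi.smul_apply, RingHom.id_apply] }
  obtain ⟨m, l, hl, hgl⟩ := farkas_eq_le
    (Sum.elim row (Sum.elim col fun _ : Unit => Matrix.traceLinearMap (Fin K) ℝ ℝ))
    (fun p : Fin K × Fin K => Matrix.entryLinearMap ℝ ℝ p.1 p.2)
    (Finset.univ.filter fun p => X p.1 p.2 = 0) g (by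
      intro d hd hd'
      -- Sign conditions on `d` are needed only at zero entries of `X`: the positive ones stay
      -- positive for small `t`, so `d` is a feasible direction.
      have hev : ∀ᶠ t : ℝ in 𝓝[>] 0, ∀ j k, 0 ≤ X j k + t * d j k := by
        rw [Filter.eventually_all]
        intro j
        rw [Filter.eventually_all]
        intro k
        rcases eq_or_lt_of_le (hX.2.2.2 j k) with h0 | h0
        · filter_upwards [self_mem_nhdsWithin] with t ht
          have hdjk : 0 ≤ d j k := hd' (j, k) (by simp [← h0])
          rw [← h0, zero_add]
          exact mul_nonneg (le_of_lt ht) hdjk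
        · have hc : Continuous fun t : ℝ => X j k + t * d j k := by fun_prop
          have hc0 := hc.tendsto 0
          simp only [zero_mul, add_zero] at hc0
          filter_upwards [(hc0.mono_left nhdsWithin_le_nhds).eventually_const_lt h0] with t ht
          exact ht.le
      obtain ⟨t, ht, ht0⟩ := (hev.and self_mem_nhdsWithin).exists
      have ht0 : 0 < t := ht0
      have hrow : d.mulVec e = 0 := funext fun j => hd (.inl j)
      have hcol : d.transpose.mulVec ((Matrix.diagonal e).mulVec ϱ) = 0 :=
        funext fun k => hd (.inr (.inl k))
      have htr : d.trace = 0 := hd (.inr (.inr ()))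
      have := hg (X + t • d) ⟨by rw [Matrix.add_mulVec, Matrix.smul_mulVec, hrow, hX.1]; simp,
        by rw [Matrix.transpose_add, Matrix.transpose_smul, Matrix.add_mulVec, Matrix.smul_mulVec,
          hcol, hX.2.1]; simp,
        by rw [Matrix.trace_add, Matrix.trace_smul, htr, hX.2.2.1]; simp, ht⟩
      rw [add_sub_cancel_left, map_smul, smul_eq_mul] at this
      exact nonneg_of_mul_nonneg_right this ht0)
  -- Multipliers are discarded where `X` is nonzero, which yields complementarity.
  refine ⟨fun j => m (.inl j), fun k => m (.inr (.inl k)), m (.inr (.inr ())),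
    Matrix.of fun j k => if X j k = 0 then l (j, k) else 0, fun j k => ?_, ?_, ?_⟩
  · rw [Matrix.of_apply]
    split_ifs
    exacts [hl _, le_rfl]
  · rw [matInner_eq_sum]
    refine Finset.sum_eq_zero fun j _ => Finset.sum_eq_zero fun k _ => ?_
    by_cases h : X j k = 0 <;> simp [h]
  · ext j k
    have hrow : ∀ j', row j' (Matrix.single j k 1) = if j = j' then e k else 0 := fun j' => by
      simp [row, Matrix.mulVec, dotProduct, Matrix.single_apply, ite_and]
    have hcol : ∀ k', col k' (Matrix.single j k 1) = if k = k' then e j * ϱ j else 0 := fun k' => by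
      simp [col, Matrix.mulVec, dotProduct, Matrix.single_apply, Matrix.diagonal_apply, ite_and]
    have htr : Matrix.traceLinearMap (Fin K) ℝ ℝ (Matrix.single j k 1) = if j = k then 1 else 0 := by
      simp [Matrix.trace, Matrix.single_apply, ite_and, eq_comm]
    have hent : ∀ p : Fin K × Fin K, Matrix.entryLinearMap ℝ ℝ p.1 p.2 (Matrix.single j k 1) =
        if p = (j, k) then (1 : ℝ) else 0 := fun p => by
      simp [Matrix.single_apply, Prod.ext_iff, eq_comm]
    rw [Matrix.of_apply, hgl]
    simp only [LinearMap.add_apply, LinearMap.sum_apply, LinearMap.smul_apply, Fintype.sum_sum_type,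
      Sum.elim_inl, Sum.elim_inr, hrow, hcol, htr, hent]
    simp [Matrix.vecMulVec_apply, Matrix.one_apply, Matrix.mulVec_diagonal,
      mul_comm]
    exact (add_assoc _ _ _).symm

end Blockwise

/-! ### Transfer to a Euclidean space. -/

section Vectorization

variable {n K : ℕ}

/-- Tuples of matrices as vectors of a Euclidean space. -/
noncomputable def vec : Blocks n K ≃ₗ[ℝ] EuclideanSpace ℝ (Fin n × Fin K × Fin K) where
  toFun Z := WithLp.toLp 2 fun p => Z p.1 p.2.1 p.2.2
  invFun x := fun i => Matrix.of fun j k => x (i, j, k)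
  map_add' _ _ := rfl
  map_smul' _ _ := rfl
  left_inv _ := rfl
  right_inv _ := rfl

theorem vec_apply (Z : Blocks n K) (p : Fin n × Fin K × Fin K) : vec Z p = Z p.1 p.2.1 p.2.2 := rfl

theorem norm_vec (Z : Blocks n K) : ‖vec Z‖ = blocksNorm Z := by
  rw [EuclideanSpace.norm_eq, blocksNorm, Fintype.sum_prod_type]
  simp only [Fintype.sum_prod_type, vec_apply, Real.norm_eq_abs, sq_abs]

theorem inner_vec (Z W : Blocks n K) : inner ℝ (vec Z) (vec W) = ∑ i, matInner (Z i) (W i) := by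
  simp only [PiLp.inner_apply, vec_apply, Fintype.sum_prod_type, matInner_eq_sum]
  simp [mul_comm]

theorem continuous_vec_symm : Continuous (vec (n := n) (K := K)).symm := by
  refine continuous_pi fun i => continuous_pi fun j => continuous_pi fun k => ?_
  exact (EuclideanSpace.proj (𝕜 := ℝ) (i, j, k)).continuous

theorem tendsto_of_tendsto_vec {Z : ℕ → Blocks n K}
    {y : EuclideanSpace ℝ (Fin n × Fin K × Fin K)}
    (h : Filter.Tendsto (fun k => vec (Z k)) Filter.atTop (𝓝 y)) :
    Filter.Tendsto Z Filter.atTop (𝓝 (vec.symm y)) := by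
  simpa [Function.comp_def] using (continuous_vec_symm.tendsto y).comp h

variable (e ϱ : Fin K → ℝ) (c : Matrix (Fin K) (Fin K) ℝ) (β : ℝ)

/-- The feasible set in vectorized form. -/
def vecFeasible : Set (EuclideanSpace ℝ (Fin n × Fin K × Fin K)) :=
  vec.symm ⁻¹' feasible e ϱ

variable {e ϱ} in
theorem vec_mem_vecFeasible {Z : Blocks n K} : vec Z ∈ vecFeasible e ϱ ↔ Z ∈ feasible e ϱ := by
  rw [vecFeasible, Set.mem_preimage, LinearEquiv.symm_apply_apply]

theorem isPolyhedron_vecFeasible : IsPolyhedron (vecFeasible (n := n) e ϱ) :=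
  (isPolyhedron_feasible e ϱ).preimage vec.symm.toLinearMap

variable {e ϱ} in
-- Nonnegative entries with `W e = 1` and `e > 0` are bounded by the reciprocals of the entries of
-- `e`.
theorem isCompact_vecFeasible (he : ∀ k, 0 < e k) : IsCompact (vecFeasible (n := n) e ϱ) := by
  have hbox : IsCompact (WithLp.toLp 2 '' Set.Icc (0 : Fin n × Fin K × Fin K → ℝ)
      fun p => (e p.2.2)⁻¹) := isCompact_Icc.image (PiLp.continuous_toLp 2 _)
  refine hbox.of_isClosed_subset (isPolyhedron_vecFeasible e ϱ).isClosed fun x hx => ?_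
  refine ⟨WithLp.ofLp x, ⟨fun p => (hx p.1).2.2.2 p.2.1 p.2.2, fun p => ?_⟩, rfl⟩
  have hrow : ∑ k, vec.symm x p.1 p.2.1 k * e k = 1 := congrFun (hx p.1).1 p.2.1
  show x p ≤ (e p.2.2)⁻¹
  rw [← one_div, le_div_iff₀ (he _), ← hrow]
  exact Finset.single_le_sum (f := fun k => vec.symm x p.1 p.2.1 k * e k)
    (fun k _ => mul_nonneg ((hx p.1).2.2.2 p.2.1 k) (he k).le) (Finset.mem_univ p.2.2)

/-- The linear part of the penalized energy in vectorized form. -/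
noncomputable def vecLinear : EuclideanSpace ℝ (Fin n × Fin K × Fin K) →L[ℝ] ℝ :=
  (linearPart e ϱ c ∘ₗ vec.symm.toLinearMap).toContinuousLinearMap

/-- The cross terms of the penalized energy in vectorized form. -/
noncomputable def vecCross : EuclideanSpace ℝ (Fin n × Fin K × Fin K) →L[ℝ]
    EuclideanSpace ℝ (Fin n × Fin K × Fin K) →L[ℝ] ℝ :=
  ((crossPart e ϱ c β).compl₁₂ vec.symm.toLinearMap vec.symm.toLinearMap).toContinuousBilinearMap

theorem vecLinear_vec (Z : Blocks n K) : vecLinear e ϱ c (vec Z) = linearPart e ϱ c Z := rfl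

theorem vecCross_vec (Z W : Blocks n K) :
    vecCross e ϱ c β (vec Z) (vec W) = crossPart e ϱ c β Z W := rfl

theorem quad_vec (Z : Blocks n K) :
    quad (vecLinear e ϱ c) (vecCross e ϱ c β) (vec Z) = penalized e ϱ c β Z := by
  rw [quad, vecLinear_vec, vecCross_vec, penalized_eq]

variable {e ϱ c β}

/-- The sum over `i` of the block inequalities: the new iterate always occupies the first slot of
the cross part and the old one the second, so the terms assemble bilinearly. -/
theorem isProxStep_of_isBlockOptimalSequence {σ : ℝ} {Z Zbar : ℕ → Blocks n K}
    (h : IsBlockOptimalSequence e ϱ c β σ Z Zbar) (k : ℕ) :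
    IsProxStep (vecLinear e ϱ c) (vecCross e ϱ c β) σ (vecFeasible e ϱ)
      (vec (Z k)) (vec (Z (k + 1))) (vec (Zbar (k + 1))) := by
  refine ⟨vec_mem_vecFeasible.2 fun i => (h k i).1, fun w hw => ?_⟩
  obtain ⟨W, rfl⟩ := vec.surjective w
  have hW := vec_mem_vecFeasible.1 hw
  rw [← map_sub, ← map_sub, vecLinear_vec, vecCross_vec, vecCross_vec, inner_vec]
  have hsum : W - Zbar (k + 1) =
      ∑ i, (Pi.single i (W i - Zbar (k + 1) i) : Blocks n K) :=
    (Finset.univ_sum_single (W - Zbar (k + 1))).symm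
  have hblocks := Finset.sum_nonneg fun i (_ : i ∈ Finset.univ) =>
    blockObjective_variational (h k i).1 (h k i).2 (hW i)
  rw [hsum, map_sum, map_sum, map_sum, LinearMap.sum_apply, ← hsum, Finset.mul_sum,
    ← Finset.sum_add_distrib, ← Finset.sum_add_distrib, ← Finset.sum_add_distrib]
  exact hblocks

/-- Since the feasible set is a product, criticality can be tested by varying one block at a time.
-/
theorem isKKTPoint_of_isCritical {x : EuclideanSpace ℝ (Fin n × Fin K × Fin K)}
    (hx : IsCritical (vecLinear e ϱ c) (vecCross e ϱ c β) (vecFeasible e ϱ) x) :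
    IsKKTPoint e ϱ c β (vec.symm x) := by
  obtain ⟨Z, rfl⟩ := vec.surjective x
  rw [LinearEquiv.symm_apply_apply]
  have hZ := vec_mem_vecFeasible.1 hx.1
  refine ⟨hZ, fun i => ?_⟩
  let single := LinearMap.single ℝ (fun _ : Fin n => Matrix (Fin K) (Fin K) ℝ) i
  obtain ⟨u, v, w, Φ, hΦ, hΦZ, hg⟩ := exists_multipliers (hZ i)
    ((linearPart e ϱ c + crossPart e ϱ c β Z + (crossPart e ϱ c β).flip Z) ∘ₗ single) (by
      intro W hW
      have hW' : Function.update Z i W ∈ feasible e ϱ := fun j => by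
        by_cases hj : j = i
        · subst hj; simpa using hW
        · simpa [hj] using hZ j
      have hsub : Function.update Z i W - Z = Pi.single i (W - Z i) := by
        funext j
        by_cases hj : j = i
        · subst hj; simp
        · simp [hj]
      have := hx.2 _ (vec_mem_vecFeasible.2 hW')
      rwa [← map_sub, slope_apply, vecLinear_vec, vecCross_vec, vecCross_vec, hsub] at this)
  refine ⟨u, v, w, Φ, hΦ, hΦZ, hg ▸ ?_⟩
  ext j k
  rw [blockGradient_apply]
  rfl

theorem F_of_mem_feasible {Z : Blocks n K} (hZ : Z ∈ feasible e ϱ) :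
    F e ϱ c β Z = (penalized e ϱ c β Z : EReal) := by
  have : ∀ i, delta (feasibleBlock e ϱ) (Z i) = 0 := fun i =>
    Set.indicator_of_notMem (Set.notMem_compl_iff.2 (hZ i)) _
  simp [F, this]

theorem RunAssumptions.antitone {σ : ℝ} {Z Zbar : ℕ → Blocks n K}
    (h : RunAssumptions e ϱ c β σ Z Zbar) :
    Antitone fun k => quad (vecLinear e ϱ c) (vecCross e ϱ c β) (vec (Zbar (k + 1))) := by
  refine antitone_nat_of_succ_le fun k => ?_
  have := h.nonincreasing (k + 1) (Nat.le_add_left 1 k)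
  rw [F_of_mem_feasible fun i => (h.blockOptimal k i).1,
    F_of_mem_feasible fun i => (h.blockOptimal (k + 1) i).1, EReal.coe_le_coe_iff] at this
  rwa [quad_vec, quad_vec]

theorem isGlobalMinimizer_iff_vec {Z : Blocks n K} :
    IsGlobalMinimizer e ϱ c β Z ↔ vec Z ∈ vecFeasible e ϱ ∧ ∀ w ∈ vecFeasible (n := n) e ϱ,
      quad (vecLinear e ϱ c) (vecCross e ϱ c β) (vec Z) ≤
        quad (vecLinear e ϱ c) (vecCross e ϱ c β) w := by
  simp only [IsGlobalMinimizer, vec.surjective.forall, vec_mem_vecFeasible, quad_vec]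

end Vectorization

end PBCD

/-! ### The theorem for matrix blocks. -/

theorem theorem3p2 (N K : ℕ) (hN : 2 ≤ N)
    (e ϱ : Fin K → ℝ) (he : ∀ k, 0 < e k) (hϱ : ∀ k, 0 ≤ ϱ k)
    (c : Matrix (Fin K) (Fin K) ℝ) (β : ℝ) (hβ : 0 < β) :
    ∃ σ₀ : ℝ, 0 < σ₀ ∧ ∀ σ : ℝ, σ₀ ≤ σ →
      (∀ Z Zbar : ℕ → PBCD.Blocks (N - 1) K, PBCD.RunAssumptions e ϱ c β σ Z Zbar →
        ∃ Zlim : PBCD.Blocks (N - 1) K, PBCD.IsKKTPoint e ϱ c β Zlim ∧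
          Filter.Tendsto Z Filter.atTop (𝓝 Zlim)) ∧
      (∃ η : ℝ, 0 < η ∧ ∃ δ : ℝ, 0 < δ ∧
        ∀ Z Zbar : ℕ → PBCD.Blocks (N - 1) K, PBCD.RunAssumptions e ϱ c β σ Z Zbar →
          (∑' k, PBCD.blocksNorm (Zbar (k + 1) - Z (k + 1))) < η →
          Z 0 ∈ PBCD.feasible e ϱ →
          (∃ Zopt : PBCD.Blocks (N - 1) K, PBCD.IsGlobalMinimizer e ϱ c β Zopt ∧
            PBCD.blocksNorm (Z 0 - Zopt) < δ) →
          ∃ Zlim : PBCD.Blocks (N - 1) K, PBCD.IsGlobalMinimizer e ϱ c β Zlim ∧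
            Filter.Tendsto Z Filter.atTop (𝓝 Zlim)) := by
  have hP := PBCD.isPolyhedron_vecFeasible (n := N - 1) e ϱ
  have hc := PBCD.isCompact_vecFeasible (n := N - 1) (ϱ := ϱ) he
  have hnorm : ∀ Z Zbar : ℕ → PBCD.Blocks (N - 1) K,
      (fun k => ‖PBCD.vec (Zbar (k + 1)) - PBCD.vec (Z (k + 1))‖) =
        fun k => PBCD.blocksNorm (Zbar (k + 1) - Z (k + 1)) := fun Z Zbar => by
    simp only [← map_sub, PBCD.norm_vec]
  -- The threshold 1 is arbitrary: the argument needs only `0 < σ`.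
  refine ⟨1, one_pos, fun σ hσ => ?_⟩
  have hσ0 : 0 < σ := one_pos.trans_le hσ
  constructor
  · intro Z Zbar h
    obtain ⟨y, hy, -, hlim⟩ := PBCD.exists_tendsto_of_isProxStep hP hc hσ0
      (z := fun k => PBCD.vec (Z k)) (x := fun k => PBCD.vec (Zbar k))
      (PBCD.isProxStep_of_isBlockOptimalSequence h.blockOptimal) h.antitone
      (by rw [hnorm]; exact h.summable)
    exact ⟨PBCD.vec.symm y, PBCD.isKKTPoint_of_isCritical hy, PBCD.tendsto_of_tendsto_vec hlim⟩
  · obtain ⟨η, hη, δ, hδ, hmain⟩ := PBCD.exists_tendsto_minimizer_of_isProxStep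
      (PBCD.vecLinear e ϱ c) (PBCD.vecCross e ϱ c β) hP hc hσ0
    refine ⟨η, hη, δ, hδ, fun Z Zbar h hsum hZ0 ⟨O, hO, hOδ⟩ => ?_⟩
    have hO' := PBCD.isGlobalMinimizer_iff_vec.1 hO
    obtain ⟨y, hyP, hymin, hlim⟩ := hmain (fun k => PBCD.vec (Z k)) (fun k => PBCD.vec (Zbar k))
      (PBCD.isProxStep_of_isBlockOptimalSequence h.blockOptimal) h.antitone
      (by rw [hnorm]; exact h.summable) (by rw [hnorm]; exact hsum)
      (PBCD.vec_mem_vecFeasible.2 hZ0)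
      ⟨PBCD.vec O, hO'.1, hO'.2, by rwa [← map_sub, PBCD.norm_vec]⟩
    refine ⟨PBCD.vec.symm y, PBCD.isGlobalMinimizer_iff_vec.2 ?_, PBCD.tendsto_of_tendsto_vec hlim⟩
    rw [LinearEquiv.apply_symm_apply]
    exact ⟨hyP, hymin⟩
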